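/- Let $D=\{z\in\mathbb C: |z|<1\}$, let $n$ be a positive integer or $n=\infty$, and let $(X/\Delta)$ be the orbifold $\left(D/(1-\tfrac1n)\{0\}\right)$, i.e. $X=D$ and $\Delta=(1-\tfrac1n)\{0\}$ with $\tfrac1\infty=0$. Put $X'=D$ if $n<\infty$ and $X'=D\setminus\{0\}$ if $n=\infty$. For $n<\infty$, an orbifold morphism (resp. a classical orbifold morphism) $D\to(X/\Delta)$ is a holomorphic map $h:D\to D$ such that, if $n\ge 2$, $h\not\equiv 0$ and at every zero of $h$ the vanishing order of $h$ is at least $n$ (resp. is a multiple of $n$); for $n=\infty$ both notions mean a holomorphic map $h:D\to D\setminus\{0\}$. Let $d_P$ be the Poincaré distance on $D$, i.e. the distance induced by the metric $\frac{4\,dz\,d\bar z}{(1-|z|^2)^2}$. The orbifold Kobayashi pseudo-distance $d_{(X/\Delta)}$ (resp. the classical orbifold Kobayashi pseudo-distance $d^*_{(X/\Delta)}$) is the largest pseudo-distance $\delta$ on $X'$ such that $\delta(g(z),g(w))\le d_P(z,w)$ for all $z,w\in D$ and every orbifold morphism (resp. classical orbifold morphism) $g:D\to(X/\Delta)$. Then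 both of these largest pseudo-distances exist, and $$d_{(X/\Delta)}=d^*_{(X/\Delta)}=d,$$ where $d$ is the distance induced on $X'$ (infimum of the lengths of $C^1$ paths in $X'$ joining two points) by the metric $$\omega=\frac{4\,dz\,d\bar z}{n^2|z|^{2-\frac2n}\left(1-|z|^{\frac2n}\right)^2}\quad\text{if } n<\infty,\qquad \omega=\frac{4\,dz\,d\bar z}{|z|^2\left(\log|z|^2\right)^2}\quad\text{if } n=\infty.$$ -/

import Mathlib

open scoped ENNReal

noncomputable section

namespace OrbifoldKobayashi

/-- The open unit disk `D` in `ℂ`. -/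
def unitDisk : Set ℂ := Metric.ball 0 1

/-- A one-dimensional geometric orbifold `(X/Δ)` on an open set `X ⊆ ℂ`, where
`Δ = ∑ p, (1 - 1 / mult p) • {p}`. The points with `mult p = 1` have coefficient `0`. -/
structure PlaneOrbifold where
  carrier : Set ℂ
  isOpen_carrier : IsOpen carrier
  mult : ℂ → ℕ∞
  mult_pos : ∀ p, 0 < mult p
  /-- Only points of `X` occur in `Δ`. -/
  mem_carrier_of_mult_ne_one : ∀ p, mult p ≠ 1 → p ∈ carrier
  /-- The sum defining `Δ` is locally finite on `X`. -/
  locally_finite : ∀ p ∈ carrier, ∃ U ∈ nhds p, {q ∈ U | mult q ≠ 1}.Finite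

namespace PlaneOrbifold

variable (X : PlaneOrbifold)

/-- The support of `Δ`. -/
def supp : Set ℂ := {p | X.mult p ≠ 1}

/-- `Δ₁`, the set of the points with coefficient `1` in `Δ`, i.e. of infinite multiplicity. -/
def deltaOne : Set ℂ := {p | X.mult p = ⊤}

/-- The set `X \ Δ₁`, as a type. -/
abbrev Points : Type := {p : ℂ // p ∈ X.carrier \ X.deltaOne}

/-- `h : D → X` is a (non-classical) orbifold morphism. The multiplicity at `x` of the divisor
`h^*{p}` is the order of vanishing of `h - p` at `x`. -/
structure IsOrbifoldMorphism (h : ℂ → ℂ) : Prop where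
  differentiableOn : DifferentiableOn ℂ h unitDisk
  mapsTo : Set.MapsTo h unitDisk X.carrier
  not_subset : ¬ h '' unitDisk ⊆ X.supp
  le_order : ∀ p ∈ X.supp, X.mult p ≠ ⊤ → ∀ x ∈ unitDisk, h x = p →
    X.mult p ≤ analyticOrderAt (fun t => h t - p) x
  avoids : ∀ p, X.mult p = ⊤ → ∀ x ∈ unitDisk, h x ≠ p

/-- `h : D → X` is a classical orbifold morphism: multiplicities are multiples of `mult p`. -/
structure IsClassicalOrbifoldMorphism (h : ℂ → ℂ) : Prop where
  differentiableOn : DifferentiableOn ℂ h unitDisk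
  mapsTo : Set.MapsTo h unitDisk X.carrier
  not_subset : ¬ h '' unitDisk ⊆ X.supp
  dvd_order : ∀ p ∈ X.supp, X.mult p ≠ ⊤ → ∀ x ∈ unitDisk, h x = p →
    X.mult p ∣ analyticOrderAt (fun t => h t - p) x
  avoids : ∀ p, X.mult p = ⊤ → ∀ x ∈ unitDisk, h x ≠ p

variable {X}

theorem IsOrbifoldMorphism.mem {h : ℂ → ℂ} (H : X.IsOrbifoldMorphism h) {z : ℂ}
    (hz : z ∈ unitDisk) : h z ∈ X.carrier \ X.deltaOne :=
  ⟨H.mapsTo hz, fun hp => H.avoids _ hp z hz rfl⟩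

theorem IsClassicalOrbifoldMorphism.mem {h : ℂ → ℂ} (H : X.IsClassicalOrbifoldMorphism h) {z : ℂ}
    (hz : z ∈ unitDisk) : h z ∈ X.carrier \ X.deltaOne :=
  ⟨H.mapsTo hz, fun hp => H.avoids _ hp z hz rfl⟩

end PlaneOrbifold

/-- A pseudo-distance on a set. -/
structure IsPseudoDist {α : Type} (d : α → α → ℝ) : Prop where
  nonneg : ∀ x y, 0 ≤ d x y
  self : ∀ x, d x x = 0
  symm : ∀ x y, d x y = d y x
  triangle : ∀ x y z, d x z ≤ d x y + d y z

/-- The length of the path `γ : [0, 1] → ℂ` for the (possibly singular) metric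
`ω = c(z) dz dz̄`, that is, the integral of `√(c (γ t)) * |γ' t|` over `[0, 1]`. -/
def pathLength (c : ℂ → ℝ≥0∞) (γ : ℝ → ℂ) : ℝ≥0∞ :=
  ∫⁻ t in Set.Icc (0 : ℝ) 1, c (γ t) ^ (1 / 2 : ℝ) * ‖derivWithin γ (Set.Icc 0 1) t‖ₑ

/-- The distance on `Y ⊆ ℂ` induced by `ω = c(z) dz dz̄`: the infimum of the lengths of the `C¹`
paths in `Y` from `x` to `y`. The velocity may vanish, so piecewise `C¹` paths give the same
infimum. -/
def inducedEDist (Y : Set ℂ) (c : ℂ → ℝ≥0∞) (x y : ℂ) : ℝ≥0∞ :=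
  ⨅ (γ : ℝ → ℂ) (_ : ContDiffOn ℝ 1 γ (Set.Icc 0 1)) (_ : Set.MapsTo γ (Set.Icc 0 1) Y)
    (_ : γ 0 = x) (_ : γ 1 = y), pathLength c γ

/-- The coefficient of the Poincaré metric `4 dz dz̄ / (1 - |z|²)²`. -/
def poincareCoeff (z : ℂ) : ℝ≥0∞ :=
  4 / ENNReal.ofReal ((1 - ‖z‖ ^ 2) ^ 2)

/-- The Poincaré distance `d_P` on the unit disk, induced by the Poincaré metric. -/
def poincareEDist : ℂ → ℂ → ℝ≥0∞ := inducedEDist unitDisk poincareCoeff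

namespace PlaneOrbifold

variable (X : PlaneOrbifold)

/-- The pseudo-distances `d` on `X \ Δ₁` such that `g^* d ≤ d_P` for every orbifold morphism
`g : D → (X/Δ)`. -/
def decreasingPseudoDists : Set (X.Points → X.Points → ℝ) :=
  {d | IsPseudoDist d ∧ ∀ (g : ℂ → ℂ) (hg : X.IsOrbifoldMorphism g) (z w : ℂ)
    (hz : z ∈ unitDisk) (hw : w ∈ unitDisk),
    ENNReal.ofReal (d ⟨g z, hg.mem hz⟩ ⟨g w, hg.mem hw⟩) ≤ poincareEDist z w}

/-- The pseudo-distances `d` on `X \ Δ₁` such that `g^* d ≤ d_P` for every classical orbifold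
morphism `g : D → (X/Δ)`. -/
def classicalDecreasingPseudoDists : Set (X.Points → X.Points → ℝ) :=
  {d | IsPseudoDist d ∧ ∀ (g : ℂ → ℂ) (hg : X.IsClassicalOrbifoldMorphism g) (z w : ℂ)
    (hz : z ∈ unitDisk) (hw : w ∈ unitDisk),
    ENNReal.ofReal (d ⟨g z, hg.mem hz⟩ ⟨g w, hg.mem hw⟩) ≤ poincareEDist z w}

/-- The orbifold Kobayashi pseudo-distance `d_(X/Δ)`: the pointwise supremum of
`decreasingPseudoDists`, which is its largest element whenever there is one. -/
def kobayashiDist (x y : X.Points) : ℝ := sSup {r | ∃ d ∈ X.decreasingPseudoDists, d x y = r}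

/-- The classical orbifold Kobayashi pseudo-distance `d^*_(X/Δ)`. -/
def classicalKobayashiDist (x y : X.Points) : ℝ :=
  sSup {r | ∃ d ∈ X.classicalDecreasingPseudoDists, d x y = r}

end PlaneOrbifold

/-- The orbifold `(D / (1 - 1/n){0})`, with `0 < n ∈ ℕ ∪ {∞}`. -/
def orbifoldDisk (n : ℕ∞) (hn : 0 < n) : PlaneOrbifold where
  carrier := unitDisk
  isOpen_carrier := Metric.isOpen_ball
  mult p := if p = 0 then n else 1
  mult_pos p := by
    split_ifs
    · exact hn
    · exact one_pos
  mem_carrier_of_mult_ne_one p hp := by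
    by_cases h : p = 0
    · subst h; simp [unitDisk]
    · simp [h] at hp
  locally_finite p _ := by
    refine ⟨Set.univ, Filter.univ_mem, (Set.finite_singleton (0 : ℂ)).subset ?_⟩
    rintro q ⟨-, hq⟩
    by_contra h
    have h' : q ≠ 0 := h
    simp [h'] at hq

/-- The coefficient of the metric `ω` on the orbifold disk:
`4 dz dz̄ / (n² |z|^(2 - 2/n) (1 - |z|^(2/n))²)` for finite `n`, and
`4 dz dz̄ / (|z|² (log |z|²)²)` for `n = ∞`. For `2 ≤ n < ∞` its value at `0` is `∞`. -/
def orbifoldCoeff : ℕ∞ → ℂ → ℝ≥0∞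
  | (n : ℕ), z => 4 / ENNReal.ofReal
      ((n : ℝ) ^ 2 * ‖z‖ ^ (2 - 2 / (n : ℝ)) * (1 - ‖z‖ ^ (2 / (n : ℝ))) ^ 2)
  | ⊤, z => 4 / ENNReal.ofReal (‖z‖ ^ 2 * Real.log (‖z‖ ^ 2) ^ 2)

end OrbifoldKobayashi

end

/-!
Let `τ = 1 / n`, with `τ = 0` for `n = ∞`. For `t > τ` the pullback by an orbifold morphism `g` of
the conical metric of exponent `t` on the disk has a density which vanishes at the zeros of `g`, so
that, after a dilation of the disk, its ratio to the Poincaré density attains its maximum at an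
interior point where `g ≠ 0`. There it is the corresponding ratio for a local branch `f` of `g ^ t`.
If it exceeded `1`, the derivative of `f` in coordinates recentred by disk automorphisms would
violate the maximum modulus principle. Letting `t` decrease to `τ` gives the Ahlfors–Schwarz
inequality `g^* ω ≤ ω_P`, hence the distance induced by `ω` is decreasing for orbifold morphisms.

It dominates every `δ` that is decreasing for classical orbifold morphisms because `ω` pulls back to
the Poincaré metric under the universal covering `z ↦ z ^ n`, or `exp` of a Cayley transform when
`n = ∞`, which is a classical orbifold morphism: a path avoiding `0` lifts to `D` with the same
length. A path meeting `0` is cut at its first and last zeros, `δ` being continuous at `0`.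
-/

noncomputable section

namespace OrbifoldKobayashi

open Metric Set Filter Topology ComplexConjugate MeasureTheory

section AhlforsSchwarz

variable {f g : ℂ → ℂ} {t : ℝ} {z z₀ w : ℂ}

theorem one_sub_norm_sq_pos (hz : ‖z‖ < 1) : 0 < 1 - ‖z‖ ^ 2 :=
  sub_pos.2 (pow_lt_one₀ (norm_nonneg z) hz two_ne_zero)

theorem norm_one_sub_conj_mul_sq (z w : ℂ) :
    ‖1 - conj w * z‖ ^ 2 = ‖z - w‖ ^ 2 + (1 - ‖z‖ ^ 2) * (1 - ‖w‖ ^ 2) := by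
  simp only [Complex.sq_norm, Complex.normSq_apply, Complex.sub_re, Complex.sub_im, Complex.mul_re,
    Complex.mul_im, Complex.one_re, Complex.one_im, Complex.conj_re, Complex.conj_im]
  ring

theorem one_sub_conj_mul_ne_zero (hz : ‖z‖ < 1) (hw : ‖w‖ < 1) : 1 - conj w * z ≠ 0 := by
  rw [← norm_ne_zero_iff, ← sq_pos_iff, norm_one_sub_conj_mul_sq]
  have := mul_pos (one_sub_norm_sq_pos hz) (one_sub_norm_sq_pos hw)
  positivity

/-- Half the density of the pullback by `g` of the conical metric
`4 t² |w| ^ (2 t - 2) / (1 - |w| ^ (2 t))² dw dw̄` on the disk, which is itself the pullback of the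
Poincaré metric by the multivalued function `w ↦ w ^ t`. -/
def conicDensity (t : ℝ) (g : ℂ → ℂ) (z : ℂ) : ℝ :=
  t * ‖g z‖ ^ (t - 1) * ‖deriv g z‖ / (1 - ‖g z‖ ^ (2 * t))

theorem conicDensity_one (f : ℂ → ℂ) (z : ℂ) :
    conicDensity 1 f z = ‖deriv f z‖ / (1 - ‖f z‖ ^ 2) := by
  simp [conicDensity]

theorem conicDensity_comp_mul_left (t : ℝ) (g : ℂ → ℂ) (r : ℝ) (z : ℂ) :
    conicDensity t (fun ζ => g (r * ζ)) z = |r| * conicDensity t g (r * z) := by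
  have hderiv : deriv (fun ζ => g (r * ζ)) z = r * deriv g (r * z) :=
    deriv_comp_mul_left (r : ℂ) g z
  simp only [conicDensity, hderiv, norm_mul, Complex.norm_real, Real.norm_eq_abs]
  ring

theorem one_sub_norm_rpow_pos (ht : 0 < t) (hz : ‖z‖ < 1) : 0 < 1 - ‖z‖ ^ (2 * t) :=
  sub_pos.2 (Real.rpow_lt_one (norm_nonneg z) hz (by positivity))

theorem continuousAt_conicDensity (ht : 0 < t) (hg : AnalyticAt ℂ g z₀) (hg₁ : ‖g z₀‖ < 1)
    (hspeed : ContinuousAt (fun z => ‖g z‖ ^ (t - 1) * ‖deriv g z‖) z₀) :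
    ContinuousAt (conicDensity t g) z₀ := by
  unfold conicDensity
  simp only [mul_assoc t]
  exact (continuousAt_const.mul hspeed).div₀
    (continuousAt_const.sub (hg.continuousAt.norm.rpow_const (Or.inr (by positivity))))
    (one_sub_norm_rpow_pos ht hg₁).ne'

theorem norm_one_sub_conj_mul_self (hw : ‖w‖ < 1) : ‖1 - conj w * w‖ = 1 - ‖w‖ ^ 2 := by
  have : 1 - conj w * w = ((1 - ‖w‖ ^ 2 : ℝ) : ℂ) := by rw [Complex.conj_mul']; push_cast; rfl
  rw [this, Complex.norm_real, Real.norm_of_nonneg (one_sub_norm_sq_pos hw).le]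

theorem eventually_norm_sub_mul_lt (hf : DifferentiableAt ℂ f z₀) (hz₀ : ‖z₀‖ < 1)
    (hf₁ : ‖f z₀‖ < 1) (h : 1 - ‖f z₀‖ ^ 2 < ‖deriv f z₀‖ * (1 - ‖z₀‖ ^ 2)) :
    ∀ᶠ z in 𝓝[≠] z₀,
      ‖z - z₀‖ * ‖1 - conj (f z₀) * f z‖ < ‖f z - f z₀‖ * ‖1 - conj z₀ * z‖ := by
  have hcont {h : ℂ → ℂ} (hh : DifferentiableAt ℂ h z₀) (h₁ : ‖h z₀‖ < 1) :
      Tendsto (fun z => ‖1 - conj (h z₀) * h z‖) (𝓝[≠] z₀) (𝓝 (1 - ‖h z₀‖ ^ 2)) := by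
    rw [← norm_one_sub_conj_mul_self h₁]
    have hc : ContinuousAt (fun z => ‖1 - conj (h z₀) * h z‖) z₀ :=
      (continuousAt_const.sub (continuousAt_const.mul hh.continuousAt)).norm
    exact hc.tendsto.mono_left nhdsWithin_le_nhds
  have hslope := (hasDerivAt_iff_tendsto_slope.1 hf.hasDerivAt).norm
  filter_upwards [(hcont hf hf₁).eventually_lt (hslope.mul (hcont differentiableAt_id hz₀)) h,
    self_mem_nhdsWithin] with z hlt hz
  have hpos : 0 < ‖z - z₀‖ := norm_pos_iff.2 (sub_ne_zero.2 hz)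
  rw [slope_def_field, norm_div, div_mul_eq_mul_div, lt_div_iff₀ hpos, mul_comm] at hlt
  exact hlt

theorem eventually_norm_div_sq_mul_lt (hf : DifferentiableAt ℂ f z₀) (hz₀ : ‖z₀‖ < 1)
    (hf₁ : ‖f z₀‖ < 1) (h : 1 - ‖f z₀‖ ^ 2 < ‖deriv f z₀‖ * (1 - ‖z₀‖ ^ 2)) :
    ∀ᶠ z in 𝓝[≠] z₀, ‖z‖ < 1 ∧ ‖f z‖ < 1 ∧
      ‖(1 - conj z₀ * z) / (1 - conj (f z₀) * f z)‖ ^ 2 * ((1 - ‖f z‖ ^ 2) / (1 - ‖z‖ ^ 2)) <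
        (1 - ‖z₀‖ ^ 2) / (1 - ‖f z₀‖ ^ 2) := by
  have hz₁ : ∀ᶠ z in 𝓝 z₀, ‖z‖ < 1 := continuousAt_id.norm.eventually_lt_const hz₀
  have hfz₁ : ∀ᶠ z in 𝓝 z₀, ‖f z‖ < 1 := hf.continuousAt.norm.eventually_lt_const hf₁
  filter_upwards [eventually_norm_sub_mul_lt hf hz₀ hf₁ h, nhdsWithin_le_nhds hz₁,
    nhdsWithin_le_nhds hfz₁] with z hlt hz hfz
  refine ⟨hz, hfz, ?_⟩
  have hB : 0 < ‖1 - conj (f z₀) * f z‖ ^ 2 :=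
    pow_pos (norm_pos_iff.2 (one_sub_conj_mul_ne_zero hfz hf₁)) 2
  have hsq := pow_lt_pow_left₀ hlt (by positivity) two_ne_zero
  rw [norm_div, div_pow, div_mul_div_comm,
    div_lt_div_iff₀ (mul_pos hB (one_sub_norm_sq_pos hz)) (one_sub_norm_sq_pos hf₁)]
  rw [mul_pow, mul_pow, norm_one_sub_conj_mul_sq, norm_one_sub_conj_mul_sq] at hsq
  rw [norm_one_sub_conj_mul_sq, norm_one_sub_conj_mul_sq]
  linear_combination hsq

theorem conicDensity_one_mul_le_of_isLocalMax (hf : AnalyticAt ℂ f z₀) (hz₀ : ‖z₀‖ < 1)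
    (hf₁ : ‖f z₀‖ < 1) (hmax : IsLocalMax (fun z => conicDensity 1 f z * (1 - ‖z‖ ^ 2)) z₀) :
    conicDensity 1 f z₀ * (1 - ‖z₀‖ ^ 2) ≤ 1 := by
  simp only [conicDensity_one] at hmax ⊢
  by_contra! hgt
  -- The modulus of this holomorphic function would have a strict maximum at `z₀`.
  set H : ℂ → ℂ := fun z => deriv f z * ((1 - conj z₀ * z) / (1 - conj (f z₀) * f z)) ^ 2
  have hlt : ∀ᶠ z in 𝓝[≠] z₀, ‖H z‖ < ‖H z₀‖ := by
    have hratio := eventually_norm_div_sq_mul_lt hf.differentiableAt hz₀ hf₁ (by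
      rwa [div_mul_eq_mul_div, one_lt_div (one_sub_norm_sq_pos hf₁)] at hgt)
    filter_upwards [hratio, nhdsWithin_le_nhds hmax] with z ⟨hz, hfz, hratio⟩ hmax
    have hα := one_sub_norm_sq_pos hz
    have hβ := one_sub_norm_sq_pos hfz
    calc ‖H z‖ = ‖deriv f z‖ / (1 - ‖f z‖ ^ 2) * (1 - ‖z‖ ^ 2) *
          (‖(1 - conj z₀ * z) / (1 - conj (f z₀) * f z)‖ ^ 2 *
            ((1 - ‖f z‖ ^ 2) / (1 - ‖z‖ ^ 2))) := by
          simp only [H, norm_mul, norm_pow]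
          field_simp
      _ ≤ ‖deriv f z₀‖ / (1 - ‖f z₀‖ ^ 2) * (1 - ‖z₀‖ ^ 2) *
          (‖(1 - conj z₀ * z) / (1 - conj (f z₀) * f z)‖ ^ 2 *
            ((1 - ‖f z‖ ^ 2) / (1 - ‖z‖ ^ 2))) := by gcongr
      _ < ‖deriv f z₀‖ / (1 - ‖f z₀‖ ^ 2) * (1 - ‖z₀‖ ^ 2) *
          ((1 - ‖z₀‖ ^ 2) / (1 - ‖f z₀‖ ^ 2)) :=
          mul_lt_mul_of_pos_left hratio (one_pos.trans hgt)
      _ = ‖H z₀‖ := by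
          simp only [H, norm_mul, norm_pow, norm_div, norm_one_sub_conj_mul_self hz₀,
            norm_one_sub_conj_mul_self hf₁]
          ring
  have hH : AnalyticAt ℂ H z₀ := by
    have := one_sub_conj_mul_ne_zero hf₁ hf₁
    exact hf.deriv.mul (((analyticAt_const.sub (analyticAt_const.mul analyticAt_id)).div
      (analyticAt_const.sub (analyticAt_const.mul hf)) this).pow 2)
  have hHmax : IsLocalMax (norm ∘ H) z₀ := by
    filter_upwards [eventually_nhdsWithin_iff.1 hlt] with z hz
    rcases eq_or_ne z z₀ with rfl | hne
    exacts [le_rfl, (hz hne).le]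
  have hconst := Complex.eventually_eq_of_isLocalMax_norm
    (hH.eventually_analyticAt.mono fun _ h => h.differentiableAt) hHmax
  obtain ⟨z, hz, heq⟩ := (hlt.and (nhdsWithin_le_nhds hconst)).exists
  exact hz.ne (congrArg norm heq)

theorem exists_eventually_norm_eq_rpow (t : ℝ) (hg : AnalyticAt ℂ g z₀) (hg₀ : g z₀ ≠ 0) :
    ∃ f : ℂ → ℂ, AnalyticAt ℂ f z₀ ∧ ∀ᶠ z in 𝓝 z₀,
      ‖f z‖ = ‖g z‖ ^ t ∧ ‖deriv f z‖ = |t| * ‖g z‖ ^ (t - 1) * ‖deriv g z‖ := by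
  have hq : AnalyticAt ℂ (fun z => g z / g z₀) z₀ := hg.fun_div analyticAt_const hg₀
  have hslit : g z₀ / g z₀ ∈ Complex.slitPlane := by
    rw [div_self hg₀]
    exact Complex.one_mem_slitPlane
  refine ⟨fun z => (g z / g z₀) ^ (t : ℂ) * (‖g z₀‖ ^ t : ℝ),
    (hq.cpow analyticAt_const hslit).mul analyticAt_const, ?_⟩
  filter_upwards [hg.eventually_analyticAt,
    hq.continuousAt.eventually_mem (Complex.isOpen_slitPlane.mem_nhds hslit)] with z hgz hz
  have hderiv := ((hgz.differentiableAt.hasDerivAt.div_const (g z₀)).cpow_const (c := t)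
    (hz : g z / g z₀ ∈ _)).mul_const ((‖g z₀‖ ^ t : ℝ) : ℂ)
  have hnorm (s : ℝ) : ‖(g z / g z₀) ^ (s : ℂ)‖ = ‖g z‖ ^ s / ‖g z₀‖ ^ s := by
    rw [Complex.norm_cpow_real, norm_div, Real.div_rpow (norm_nonneg _) (norm_nonneg _)]
  have hpos : 0 < ‖g z₀‖ := norm_pos_iff.2 hg₀
  have hreal : ‖((‖g z₀‖ ^ t : ℝ) : ℂ)‖ = ‖g z₀‖ ^ t := by
    rw [Complex.norm_real, Real.norm_of_nonneg (by positivity)]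
  have hcast : (t : ℂ) - 1 = (t - 1 : ℝ) := by push_cast; rfl
  refine ⟨by rw [norm_mul, hreal, hnorm, div_mul_cancel₀ _ (by positivity)], ?_⟩
  rw [hderiv.deriv, norm_mul, norm_mul, norm_mul, hreal, hcast, hnorm, norm_div, Complex.norm_real,
    Real.norm_eq_abs, Real.rpow_sub_one hpos.ne' t]
  field_simp

theorem conicDensity_mul_le_of_isLocalMax (ht : 0 < t) (hg : AnalyticAt ℂ g z₀) (hz₀ : ‖z₀‖ < 1)
    (hg₁ : ‖g z₀‖ < 1) (hg₀ : g z₀ ≠ 0)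
    (hmax : IsLocalMax (fun z => conicDensity t g z * (1 - ‖z‖ ^ 2)) z₀) :
    conicDensity t g z₀ * (1 - ‖z₀‖ ^ 2) ≤ 1 := by
  obtain ⟨f, hf, hfg⟩ := exists_eventually_norm_eq_rpow t hg hg₀
  have heq : conicDensity 1 f =ᶠ[𝓝 z₀] conicDensity t g := by
    filter_upwards [hfg] with z ⟨hnorm, hderiv⟩
    rw [conicDensity_one, conicDensity, hnorm, hderiv, abs_of_pos ht, mul_comm 2 t,
      Real.rpow_mul (norm_nonneg _), Real.rpow_two]
  have hf₁ : ‖f z₀‖ < 1 := by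
    rw [hfg.self_of_nhds.1]
    exact Real.rpow_lt_one (norm_nonneg _) hg₁ ht
  rw [← heq.self_of_nhds]
  refine conicDensity_one_mul_le_of_isLocalMax hf hz₀ hf₁ ?_
  exact hmax.congr (heq.symm.mono fun z hz => by simp only [hz])

theorem conicDensity_mul_le_of_analyticOnNhd_closedBall (ht : 0 < t)
    (hg : AnalyticOnNhd ℂ g (closedBall 0 1)) (hg₁ : ∀ z ∈ closedBall (0 : ℂ) 1, ‖g z‖ < 1)
    (hcont : ContinuousOn (conicDensity t g) (closedBall 0 1))
    (hzero : ∀ z ∈ closedBall (0 : ℂ) 1, g z = 0 → conicDensity t g z = 0)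
    (hz : z ∈ closedBall (0 : ℂ) 1) : conicDensity t g z * (1 - ‖z‖ ^ 2) ≤ 1 := by
  obtain ⟨z₀, hz₀, hmax⟩ := (isCompact_closedBall (0 : ℂ) 1).exists_isMaxOn ⟨z, hz⟩
    (hcont.mul (continuousOn_const.sub (continuousOn_id.norm.pow 2)))
  refine (hmax hz).trans ?_
  by_cases hg₀ : g z₀ = 0
  · simp [hzero z₀ hz₀ hg₀]
  rcases (mem_closedBall_zero_iff.1 hz₀).lt_or_eq with hlt | heq
  · exact conicDensity_mul_le_of_isLocalMax ht (hg z₀ hz₀) hlt (hg₁ z₀ hz₀) hg₀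
      (hmax.isLocalMax (closedBall_mem_nhds_of_mem (mem_ball_zero_iff.2 hlt)))
  · simp [heq]

theorem conicDensity_mul_le (ht : 0 < t) (hg : DifferentiableOn ℂ g (ball 0 1))
    (hg₁ : MapsTo g (ball 0 1) (ball 0 1)) (hcont : ContinuousOn (conicDensity t g) (ball 0 1))
    (hzero : ∀ z ∈ ball (0 : ℂ) 1, g z = 0 → conicDensity t g z = 0)
    (hz : ‖z‖ < 1) : conicDensity t g z * (1 - ‖z‖ ^ 2) ≤ 1 := by
  have hdilate : ∀ᶠ r : ℝ in 𝓝[<] 1, r * conicDensity t g z * (1 - ‖z / r‖ ^ 2) ≤ 1 := by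
    filter_upwards [Ioo_mem_nhdsLT hz] with r hr
    have hr₀ : 0 < r := (norm_nonneg z).trans_lt hr.1
    have hr₀' : (r : ℂ) ≠ 0 := by exact_mod_cast hr₀.ne'
    have hmaps : MapsTo (fun ζ : ℂ => r * ζ) (closedBall 0 1) (ball 0 1) := fun ζ hζ => by
      rw [mem_closedBall_zero_iff] at hζ
      rw [mem_ball_zero_iff, norm_mul, Complex.norm_real, Real.norm_of_nonneg hr₀.le]
      exact (mul_le_of_le_one_right hr₀.le hζ).trans_lt hr.2
    have hmul : AnalyticOnNhd ℂ (fun ζ : ℂ => r * ζ) (closedBall 0 1) :=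
      analyticOnNhd_const.mul analyticOnNhd_id
    have hbound := conicDensity_mul_le_of_analyticOnNhd_closedBall (z := z / r) ht
      ((hg.analyticOnNhd isOpen_ball).comp hmul hmaps)
      (fun ζ hζ => mem_ball_zero_iff.1 (hg₁ (hmaps hζ)))
      (((hcont.comp hmul.continuousOn hmaps).const_mul |r|).congr
        fun ζ _ => conicDensity_comp_mul_left t g r ζ)
      (fun ζ hζ h => by
        rw [Function.comp_def, conicDensity_comp_mul_left, hzero _ (hmaps hζ) h, mul_zero])
      (by
        rw [mem_closedBall_zero_iff, norm_div, Complex.norm_real, Real.norm_of_nonneg hr₀.le]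
        exact div_le_one_of_le₀ hr.1.le hr₀.le)
    rwa [Function.comp_def, conicDensity_comp_mul_left, abs_of_pos hr₀, mul_div_cancel₀ _ hr₀']
      at hbound
  refine le_of_tendsto ?_ hdilate
  have hlim : ContinuousAt (fun r : ℝ => r * conicDensity t g z * (1 - ‖z / r‖ ^ 2)) 1 := by
    fun_prop (disch := simp)
  simpa using hlim.tendsto.mono_left nhdsWithin_le_nhds

end AhlforsSchwarz

section OrbifoldSchwarz

/-- The conformal factor `ρ` for which the metric of the orbifold disk of multiplicity `n` is
`4 dz dz̄ / ρ(|z|)²`; for `n = 1` it is that of the Poincaré metric. -/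
def conformalFactor : ℕ∞ → ℝ → ℝ
  | (n : ℕ), r => n * r ^ (1 - 1 / (n : ℝ)) * (1 - r ^ (2 / (n : ℝ)))
  | ⊤, r => r * (-2 * Real.log r)

variable {n : ℕ∞} {g : ℂ → ℂ} {t r : ℝ} {z z₀ : ℂ}

theorem conformalFactor_natCast (N : ℕ) (r : ℝ) :
    conformalFactor N r = N * r ^ (1 - 1 / (N : ℝ)) * (1 - r ^ (2 / (N : ℝ))) :=
  rfl

theorem conformalFactor_top (r : ℝ) : conformalFactor ⊤ r = r * (-2 * Real.log r) :=
  rfl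

theorem conformalFactor_nonneg (n : ℕ∞) (hr₀ : 0 ≤ r) (hr₁ : r ≤ 1) : 0 ≤ conformalFactor n r := by
  induction n using ENat.recTopCoe with
  | top =>
    have := Real.log_nonpos hr₀ hr₁
    exact mul_nonneg hr₀ (by linarith)
  | coe N =>
    have : r ^ (2 / (N : ℝ)) ≤ 1 := Real.rpow_le_one hr₀ hr₁ (by positivity)
    exact mul_nonneg (by positivity) (by linarith)

theorem conformalFactor_pos (hn : n ≠ 0) (hr₀ : 0 < r) (hr₁ : r < 1) : 0 < conformalFactor n r := by
  induction n using ENat.recTopCoe with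
  | top =>
    have := Real.log_neg hr₀ hr₁
    exact mul_pos hr₀ (by linarith)
  | coe N =>
    have hN : 0 < (N : ℝ) := by exact_mod_cast Nat.pos_of_ne_zero (by exact_mod_cast hn)
    have : r ^ (2 / (N : ℝ)) < 1 := Real.rpow_lt_one hr₀.le hr₁ (by positivity)
    exact mul_pos (by positivity) (by linarith)

theorem continuous_conformalFactor (hn : n ≠ 0) : Continuous (conformalFactor n) := by
  induction n using ENat.recTopCoe with
  | top =>
    have h := Real.continuous_mul_log.const_mul (-2)
    exact h.congr fun r => by rw [conformalFactor_top]; ring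
  | coe N =>
    have hN : 1 ≤ (N : ℝ) := by exact_mod_cast Nat.one_le_iff_ne_zero.2 (by exact_mod_cast hn)
    have h₁ : Continuous fun r : ℝ => r ^ (1 - 1 / (N : ℝ)) :=
      Real.continuous_rpow_const (sub_nonneg.2 (div_le_one_of_le₀ hN (by positivity)))
    have h₂ : Continuous fun r : ℝ => r ^ (2 / (N : ℝ)) :=
      Real.continuous_rpow_const (by positivity)
    exact (continuous_const.mul h₁).mul (continuous_const.sub h₂)

-- For `n = ∞` the exponent tends to `0`, since `ENat.toNat ⊤ = 0`.
theorem tendsto_rpow_mul_one_sub_rpow_div (hn : n ≠ 0) (hr : 0 < r) :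
    Tendsto (fun t : ℝ => r ^ (1 - t) * ((1 - r ^ (2 * t)) / t)) (𝓝[>] (n.toNat : ℝ)⁻¹)
      (𝓝 (conformalFactor n r)) := by
  have hpow : Continuous fun t : ℝ => r ^ (1 - t) :=
    Real.continuous_const_rpow hr.ne' |>.comp (continuous_const.sub continuous_id)
  induction n using ENat.recTopCoe with
  | top =>
    have hderiv : HasDerivAt (fun t : ℝ => 1 - r ^ (2 * t)) (-2 * Real.log r) 0 := by
      simpa [mul_comm] using (((hasDerivAt_id (0 : ℝ)).const_mul 2).const_rpow hr).const_sub 1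
    have hslope : Tendsto (fun t : ℝ => (1 - r ^ (2 * t)) / t) (𝓝[>] 0)
        (𝓝 (-2 * Real.log r)) := by
      simpa [← div_eq_inv_mul] using hderiv.tendsto_slope_zero_right
    have hpow₀ := (hpow.tendsto 0).mono_left (nhdsWithin_le_nhds (s := Ioi 0))
    rw [sub_zero, Real.rpow_one] at hpow₀
    simpa [conformalFactor_top] using hpow₀.mul hslope
  | coe N =>
    have hN : (N : ℝ)⁻¹ ≠ 0 := inv_ne_zero (by exact_mod_cast hn)
    have hc : ContinuousAt (fun t : ℝ => r ^ (1 - t) * ((1 - r ^ (2 * t)) / t)) (N : ℝ)⁻¹ :=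
      hpow.continuousAt.mul ((continuousAt_const.sub ((Real.continuous_const_rpow hr.ne').comp
        (continuous_const.mul continuous_id)).continuousAt).div₀ continuousAt_id hN)
    have hlim := hc.tendsto.mono_left (nhdsWithin_le_nhds (s := Ioi (N : ℝ)⁻¹))
    rwa [← div_eq_mul_inv, div_inv_eq_mul, mul_comm _ (N : ℝ), mul_left_comm, ← mul_assoc,
      ← one_div, ← conformalFactor_natCast, one_div] at hlim

theorem tendsto_norm_rpow_mul_norm_deriv {k : ℕ} (hg : AnalyticAt ℂ g z₀)
    (hk : analyticOrderAt g z₀ = k) (htk : 1 < t * k) :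
    Tendsto (fun z => ‖g z‖ ^ (t - 1) * ‖deriv g z‖) (𝓝 z₀) (𝓝 0) := by
  obtain ⟨h, hh, hh₀, hgh⟩ := hg.analyticOrderAt_eq_natCast.1 hk
  have hk₀ : k ≠ 0 := by
    rintro rfl
    norm_num at htk
  have hspeed : (fun z => ‖g z‖ ^ (t - 1) * ‖deriv g z‖) =ᶠ[𝓝 z₀] fun z =>
      ‖z - z₀‖ ^ (t * k - 1) * (‖h z‖ ^ (t - 1) * ‖k * h z + (z - z₀) * deriv h z‖) := by
    filter_upwards [hgh, hgh.eventually_nhds, hh.eventually_analyticAt] with z hz hgh hhz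
    have hderiv : deriv g z = (z - z₀) ^ (k - 1) * (k * h z + (z - z₀) * deriv h z) := by
      have hprod := (((hasDerivAt_id z).sub_const z₀).pow k).smul hhz.differentiableAt.hasDerivAt
      rw [(hprod.congr_of_eventuallyEq hgh).deriv]
      simp only [id, Pi.pow_apply, smul_eq_mul]
      rw [← pow_sub_one_mul hk₀ (z - z₀)]
      ring
    have hexp : t * k - 1 = k * (t - 1) + (k - 1 : ℕ) := by
      rw [Nat.cast_pred (Nat.pos_of_ne_zero hk₀)]
      ring
    rw [hexp, Real.rpow_add' (norm_nonneg _) (by rw [← hexp]; linarith), Real.rpow_natCast,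
      Real.rpow_natCast_mul (norm_nonneg _), hderiv, hz, smul_eq_mul, norm_mul, norm_mul, norm_pow,
      norm_pow, Real.mul_rpow (by positivity) (norm_nonneg _)]
    ring
  refine Tendsto.congr' hspeed.symm ?_
  have h₁ : ContinuousAt (fun z => ‖z - z₀‖ ^ (t * k - 1)) z₀ :=
    (by fun_prop : ContinuousAt (fun z => ‖z - z₀‖) z₀).rpow_const (Or.inr (by linarith))
  have h₂ : ContinuousAt (fun z => ‖h z‖ ^ (t - 1) * ‖k * h z + (z - z₀) * deriv h z‖) z₀ :=
    (hh.continuousAt.norm.rpow_const (Or.inl (norm_ne_zero_iff.2 hh₀))).mul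
      ((continuousAt_const.mul hh.continuousAt).add
        ((by fun_prop : ContinuousAt (fun z => z - z₀) z₀).mul hh.deriv.continuousAt)).norm
  have hzero : ‖z₀ - z₀‖ ^ (t * k - 1) = 0 := by
    rw [sub_self, norm_zero, Real.zero_rpow (by linarith)]
  simpa only [hzero, zero_mul] using h₁.tendsto.mul h₂.tendsto

theorem one_lt_mul_of_inv_toNat_lt {k : ℕ} (hn : n ≠ 0) (ht : (n.toNat : ℝ)⁻¹ < t) (hk : n ≤ k) :
    1 < t * k := by
  lift n to ℕ using ne_top_of_le_ne_top (ENat.natCast_ne_top k) hk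
  have hn₀ : 0 < (n : ℝ) := by exact_mod_cast Nat.pos_of_ne_zero (by exact_mod_cast hn)
  have hnk : (n : ℝ) ≤ k := by exact_mod_cast hk
  calc 1 < t * n := by rwa [ENat.toNat_natCast, inv_lt_iff_one_lt_mul₀ hn₀] at ht
    _ ≤ t * k := by
      have : 0 < t := (inv_nonneg.2 n.cast_nonneg).trans_lt ht
      gcongr

theorem conicDensity_mul_le_of_le_analyticOrderAt (hn : n ≠ 0) (ht : (n.toNat : ℝ)⁻¹ < t)
    (hg : DifferentiableOn ℂ g (ball 0 1)) (hg₁ : MapsTo g (ball 0 1) (ball 0 1))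
    (hord : ∀ w ∈ ball (0 : ℂ) 1, g w = 0 → n ≤ analyticOrderAt g w) (hz : ‖z‖ < 1)
    (hgz : g z ≠ 0) : conicDensity t g z * (1 - ‖z‖ ^ 2) ≤ 1 := by
  have ht₀ : 0 < t := (inv_nonneg.2 n.toNat.cast_nonneg).trans_lt ht
  have han := hg.analyticOnNhd isOpen_ball
  have hspeed : ∀ w ∈ ball (0 : ℂ) 1, g w = 0 →
      Tendsto (fun z => ‖g z‖ ^ (t - 1) * ‖deriv g z‖) (𝓝 w) (𝓝 0) := fun w hw hgw => by
    have hfin : analyticOrderAt g w ≠ ⊤ :=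
      han.analyticOrderAt_ne_top_of_isPreconnected (convex_ball 0 1).isPreconnected
        (mem_ball_zero_iff.2 hz) hw (by
          rw [(han z (mem_ball_zero_iff.2 hz)).analyticOrderAt_eq_zero.2 hgz]
          exact ENat.zero_ne_top)
    obtain ⟨k, hk⟩ := ENat.ne_top_iff_exists.1 hfin
    exact tendsto_norm_rpow_mul_norm_deriv (han w hw) hk.symm
      (one_lt_mul_of_inv_toNat_lt hn ht (hk ▸ hord w hw hgw))
  refine conicDensity_mul_le ht₀ hg hg₁ (fun w hw => ?_) (fun w hw hgw => ?_) hz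
  · refine (continuousAt_conicDensity ht₀ (han w hw) (mem_ball_zero_iff.1 (hg₁ hw))
      ?_).continuousWithinAt
    by_cases hgw : g w = 0
    · exact continuousAt_of_tendsto_nhds (hspeed w hw hgw)
    · exact ((han w hw).continuousAt.norm.rpow_const (Or.inl (norm_ne_zero_iff.2 hgw))).mul
        (han w hw).deriv.continuousAt.norm
  · rw [conicDensity, mul_assoc t, eq_of_tendsto_nhds (hspeed w hw hgw), mul_zero, zero_div]

theorem norm_deriv_mul_le_conformalFactor_of_ne_zero (hn : n ≠ 0)
    (hg : DifferentiableOn ℂ g (ball 0 1)) (hg₁ : MapsTo g (ball 0 1) (ball 0 1))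
    (hord : ∀ w ∈ ball (0 : ℂ) 1, g w = 0 → n ≤ analyticOrderAt g w) (hz : ‖z‖ < 1)
    (hgz : g z ≠ 0) : ‖deriv g z‖ * (1 - ‖z‖ ^ 2) ≤ conformalFactor n ‖g z‖ := by
  have hpos : 0 < ‖g z‖ := norm_pos_iff.2 hgz
  refine ge_of_tendsto (tendsto_rpow_mul_one_sub_rpow_div hn hpos) ?_
  filter_upwards [self_mem_nhdsWithin] with t ht
  have ht₀ : 0 < t := (inv_nonneg.2 n.toNat.cast_nonneg).trans_lt ht
  have hden := one_sub_norm_rpow_pos ht₀ (mem_ball_zero_iff.1 (hg₁ (mem_ball_zero_iff.2 hz)))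
  have h := conicDensity_mul_le_of_le_analyticOrderAt hn ht hg hg₁ hord hz hgz
  rw [conicDensity, div_mul_eq_mul_div, div_le_one hden] at h
  rw [← neg_sub t 1, Real.rpow_neg hpos.le, ← div_eq_inv_mul, le_div_iff₀ (by positivity),
    le_div_iff₀ ht₀]
  linarith

theorem norm_deriv_mul_le_conformalFactor (hn : n ≠ 0)
    (hg : DifferentiableOn ℂ g (ball 0 1)) (hg₁ : MapsTo g (ball 0 1) (ball 0 1))
    (hord : ∀ w ∈ ball (0 : ℂ) 1, g w = 0 → n ≤ analyticOrderAt g w) (hz : ‖z‖ < 1) :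
    ‖deriv g z‖ * (1 - ‖z‖ ^ 2) ≤ conformalFactor n ‖g z‖ := by
  have hz' : z ∈ ball (0 : ℂ) 1 := mem_ball_zero_iff.2 hz
  have han := hg.analyticAt (isOpen_ball.mem_nhds hz')
  rcases han.eventually_eq_zero_or_eventually_ne_zero with heq | hne
  · rw [EventuallyEq.deriv_eq heq, deriv_const, norm_zero, zero_mul]
    exact conformalFactor_nonneg n (norm_nonneg _) (mem_ball_zero_iff.1 (hg₁ hz')).le
  · refine le_of_tendsto_of_tendsto (b := 𝓝[≠] z) (f := fun w => ‖deriv g w‖ * (1 - ‖w‖ ^ 2))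
      (g := fun w => conformalFactor n ‖g w‖) ?_ ?_ ?_
    · exact (han.deriv.continuousAt.norm.mul
        (continuousAt_const.sub (continuousAt_id.norm.pow 2))).tendsto.mono_left nhdsWithin_le_nhds
    · exact ((continuous_conformalFactor hn).continuousAt.comp
        han.continuousAt.norm).tendsto.mono_left nhdsWithin_le_nhds
    · filter_upwards [hne, nhdsWithin_le_nhds (isOpen_ball.mem_nhds hz')] with w hgw hw
      exact norm_deriv_mul_le_conformalFactor_of_ne_zero hn hg hg₁ hord (mem_ball_zero_iff.1 hw) hgw

end OrbifoldSchwarz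

section InducedDistance

/-- The length, for the metric `c(z) dz dz̄`, of the path `γ` over the open interval `(a, b)`. -/
def arcLength (c : ℂ → ℝ≥0∞) (γ : ℝ → ℂ) (a b : ℝ) : ℝ≥0∞ :=
  ∫⁻ t in Ioo a b, c (γ t) ^ (1 / 2 : ℝ) * ‖deriv γ t‖ₑ

variable {Y : Set ℂ} {c : ℂ → ℝ≥0∞} {γ γ₁ γ₂ : ℝ → ℂ} {φ : ℝ → ℝ} {a b a' b' : ℝ} {x y z : ℂ}

theorem pathLength_eq_arcLength (c : ℂ → ℝ≥0∞) (γ : ℝ → ℂ) :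
    pathLength c γ = arcLength c γ 0 1 := by
  rw [pathLength, arcLength, ← restrict_Ioo_eq_restrict_Icc]
  refine setLIntegral_congr_fun measurableSet_Ioo fun t ht => ?_
  rw [derivWithin_of_mem_nhds (Icc_mem_nhds ht.1 ht.2)]

theorem arcLength_congr (h : EqOn γ₁ γ₂ (Ioo a b)) : arcLength c γ₁ a b = arcLength c γ₂ a b := by
  refine setLIntegral_congr_fun measurableSet_Ioo fun t ht => ?_
  have hder : deriv γ₁ t = deriv γ₂ t :=
    (h.eventuallyEq_of_mem (isOpen_Ioo.mem_nhds ht)).deriv_eq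
  rw [h ht, hder]

theorem arcLength_mono (h : Ioo a b ⊆ Ioo a' b') : arcLength c γ a b ≤ arcLength c γ a' b' :=
  lintegral_mono_set h

theorem arcLength_add_le {d : ℝ} (hab : a ≤ b) (hbd : b ≤ d) :
    arcLength c γ a b + arcLength c γ b d ≤ arcLength c γ a d := by
  have hdisj : Disjoint (Ioo a b) (Ioo b d) :=
    disjoint_left.2 fun t ht ht' => ht.2.not_gt ht'.1
  rw [arcLength, arcLength, ← lintegral_union measurableSet_Ioo hdisj]
  exact lintegral_mono_set (union_subset (Ioo_subset_Ioo_right hbd) (Ioo_subset_Ioo_left hab))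

theorem arcLength_le_add {d : ℝ} :
    arcLength c γ a d ≤ arcLength c γ a b + arcLength c γ b d := by
  simp only [arcLength, restrict_Ioo_eq_restrict_Icc]
  exact (lintegral_mono_set Icc_subset_Icc_union_Icc).trans (lintegral_union_le _ _ _)

theorem arcLength_comp_le (hγ : DifferentiableOn ℝ γ (Ioo a' b')) (hφ : Differentiable ℝ φ)
    (hmono : Monotone φ) (hmaps : MapsTo φ (Ioo a b) (Ioo a' b')) :
    arcLength c (γ ∘ φ) a b ≤ arcLength c γ a' b' := by
  calc arcLength c (γ ∘ φ) a b
      = ∫⁻ t in Ioo a b, ENNReal.ofReal (deriv φ t) *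
          (c (γ (φ t)) ^ (1 / 2 : ℝ) * ‖deriv γ (φ t)‖ₑ) := by
        refine setLIntegral_congr_fun measurableSet_Ioo fun t ht => ?_
        have hγt := hγ.differentiableAt (isOpen_Ioo.mem_nhds (hmaps ht))
        rw [deriv.scomp t hγt (hφ t), enorm_smul, Real.enorm_of_nonneg hmono.deriv_nonneg,
          mul_left_comm, Function.comp_apply]
    _ = ∫⁻ s in φ '' Ioo a b, c (γ s) ^ (1 / 2 : ℝ) * ‖deriv γ s‖ₑ :=
        (lintegral_image_eq_lintegral_deriv_mul_of_monotoneOn measurableSet_Ioo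
          (fun t _ => (hφ t).hasDerivAt.hasDerivWithinAt) (hmono.monotoneOn _)
          fun s => c (γ s) ^ (1 / 2 : ℝ) * ‖deriv γ s‖ₑ).symm
    _ ≤ arcLength c γ a' b' := lintegral_mono_set hmaps.image_subset

theorem arcLength_comp_smoothTransition_le (hγ : DifferentiableOn ℝ γ (Icc 0 1))
    (hφ : Differentiable ℝ φ) (hmono : Monotone φ) (hmaps : MapsTo φ (Ioo a b) (Ioo 0 1)) :
    arcLength c (fun t => γ (Real.smoothTransition (φ t))) a b ≤ arcLength c γ 0 1 :=
  arcLength_comp_le (hγ.mono Ioo_subset_Icc_self)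
    ((Real.smoothTransition.contDiff.differentiable one_ne_zero).comp hφ)
    (Real.smoothTransition.monotone.comp hmono) fun _ ht =>
      ⟨Real.smoothTransition.pos_of_pos (hmaps ht).1,
        Real.smoothTransition.lt_one_of_lt_one (hmaps ht).2⟩

theorem arcLength_comp_one_sub (c : ℂ → ℝ≥0∞) (γ : ℝ → ℂ) :
    arcLength c (fun t => γ (1 - t)) 0 1 = arcLength c γ 0 1 := by
  have h := (Measure.measurePreserving_sub_left (volume : Measure ℝ)
    1).setLIntegral_comp_preimage_emb (MeasurableEquiv.subLeft (1 : ℝ)).measurableEmbedding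
    (fun t => c (γ t) ^ (1 / 2 : ℝ) * ‖deriv γ t‖ₑ) (Ioo 0 1)
  rw [preimage_const_sub_Ioo, sub_self, sub_zero] at h
  simpa only [arcLength, deriv_comp_const_sub, enorm_neg] using h

theorem inducedEDist_le (hγ : ContDiffOn ℝ 1 γ (Icc 0 1)) (hY : MapsTo γ (Icc 0 1) Y) :
    inducedEDist Y c (γ 0) (γ 1) ≤ arcLength c γ 0 1 :=
  (iInf₂_le_of_le γ hγ <| iInf_le_of_le hY <| iInf_le_of_le rfl <| iInf_le _ rfl).trans_eq
    (pathLength_eq_arcLength c γ)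

theorem le_inducedEDist {L : ℝ≥0∞} (h : ∀ γ : ℝ → ℂ, ContDiffOn ℝ 1 γ (Icc 0 1) →
    MapsTo γ (Icc 0 1) Y → γ 0 = x → γ 1 = y → L ≤ arcLength c γ 0 1) :
    L ≤ inducedEDist Y c x y :=
  le_iInf₂ fun γ hγ => le_iInf₂ fun hY hx => le_iInf fun hy =>
    (h γ hγ hY hx hy).trans_eq (pathLength_eq_arcLength c γ).symm

theorem inducedEDist_le_arcLength (hab : a < b) (hγ : ContDiffOn ℝ 1 γ (Icc a b))
    (hY : MapsTo γ (Icc a b) Y) : inducedEDist Y c (γ a) (γ b) ≤ arcLength c γ a b := by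
  have hmono : StrictMono (AffineMap.lineMap a b : ℝ → ℝ) := fun s t hst => by
    simp only [AffineMap.lineMap_apply_ring']
    gcongr
  have hmaps : MapsTo (AffineMap.lineMap a b : ℝ → ℝ) (Icc 0 1) (Icc a b) := fun t ht => by
    simpa using And.intro (hmono.monotone ht.1) (hmono.monotone ht.2)
  have hle := inducedEDist_le (c := c) (hγ.comp (AffineMap.contDiff_lineMap a b).contDiffOn hmaps)
    (hY.comp hmaps)
  simp only [Function.comp_apply, AffineMap.lineMap_apply_zero, AffineMap.lineMap_apply_one] at hle
  refine hle.trans (arcLength_comp_le ((hγ.differentiableOn_one).mono Ioo_subset_Icc_self)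
    (fun _ => AffineMap.hasDerivAt_lineMap.differentiableAt) hmono.monotone fun t ht => ?_)
  simpa using And.intro (hmono ht.1) (hmono ht.2)

theorem inducedEDist_le_mul_enorm_sub {K : ℝ≥0∞} (hY : segment ℝ x y ⊆ Y)
    (hK : ∀ z ∈ segment ℝ x y, c z ^ (1 / 2 : ℝ) ≤ K) :
    inducedEDist Y c x y ≤ K * ‖y - x‖ₑ := by
  have hmem {t : ℝ} (ht : t ∈ Icc (0 : ℝ) 1) : AffineMap.lineMap x y t ∈ segment ℝ x y := by
    rw [segment_eq_image_lineMap]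
    exact mem_image_of_mem _ ht
  have hle := inducedEDist_le (c := c) (AffineMap.contDiff_lineMap x y).contDiffOn
    fun t ht => hY (hmem ht)
  rw [AffineMap.lineMap_apply_zero, AffineMap.lineMap_apply_one] at hle
  calc inducedEDist Y c x y ≤ arcLength c (AffineMap.lineMap x y : ℝ → ℂ) 0 1 := hle
    _ ≤ ∫⁻ _ in Ioo (0 : ℝ) 1, K * ‖y - x‖ₑ := by
        refine setLIntegral_mono' measurableSet_Ioo fun t ht => ?_
        rw [AffineMap.hasDerivAt_lineMap.deriv]
        gcongr
        exact hK _ (hmem (Ioo_subset_Icc_self ht))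
    _ = K * ‖y - x‖ₑ := by simp

theorem inducedEDist_self (hx : x ∈ Y) : inducedEDist Y c x x = 0 := by
  have hle := inducedEDist_le (c := c) (γ := fun _ => x) contDiffOn_const fun _ _ => hx
  simpa [arcLength] using hle

theorem inducedEDist_comm : inducedEDist Y c x y = inducedEDist Y c y x := by
  have hle (x y : ℂ) : inducedEDist Y c x y ≤ inducedEDist Y c y x := by
    refine le_inducedEDist fun γ hγ hY hx hy => ?_
    have hmaps : MapsTo (fun t : ℝ => 1 - t) (Icc 0 1) (Icc 0 1) := fun t ht =>
      ⟨sub_nonneg.2 ht.2, sub_le_self 1 ht.1⟩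
    have h := inducedEDist_le (c := c) (hγ.comp (by fun_prop) hmaps) (hY.comp hmaps)
    simpa only [Function.comp_def, sub_zero, sub_self, hx, hy, arcLength_comp_one_sub] using h
  exact (hle x y).antisymm (hle y x)

theorem inducedEDist_le_arcLength_add_arcLength (hγ₁ : ContDiffOn ℝ 1 γ₁ (Icc 0 1))
    (hγ₂ : ContDiffOn ℝ 1 γ₂ (Icc 0 1)) (hY₁ : MapsTo γ₁ (Icc 0 1) Y)
    (hY₂ : MapsTo γ₂ (Icc 0 1) Y) (h : γ₁ 1 = γ₂ 0) :
    inducedEDist Y c (γ₁ 0) (γ₂ 1) ≤ arcLength c γ₁ 0 1 + arcLength c γ₂ 0 1 := by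
  -- Slowing both paths down smoothly at their common endpoint makes the concatenation `C¹`.
  set φ₁ : ℝ → ℝ := fun t => Real.smoothTransition (2 * t)
  set φ₂ : ℝ → ℝ := fun t => Real.smoothTransition (2 * t - 1)
  set σ : ℝ → ℂ := fun t => γ₁ (φ₁ t) + γ₂ (φ₂ t) - γ₂ 0
  have hφ₁ : ContDiff ℝ 1 φ₁ := Real.smoothTransition.contDiff.comp (by fun_prop)
  have hφ₂ : ContDiff ℝ 1 φ₂ := Real.smoothTransition.contDiff.comp (by fun_prop)
  have hmem (t : ℝ) : Real.smoothTransition t ∈ Icc (0 : ℝ) 1 :=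
    ⟨Real.smoothTransition.nonneg t, Real.smoothTransition.le_one t⟩
  have hleft : ∀ t ≤ 1 / 2, σ t = γ₁ (φ₁ t) := fun t ht => by
    simp only [σ, φ₂, Real.smoothTransition.zero_of_nonpos (by linarith : 2 * t - 1 ≤ 0),
      add_sub_cancel_right]
  have hright : ∀ t ≥ 1 / 2, σ t = γ₂ (φ₂ t) := fun t ht => by
    simp only [σ, φ₁, Real.smoothTransition.one_of_one_le (by linarith : 1 ≤ 2 * t), h,
      add_sub_cancel_left]
  have hσ : ContDiffOn ℝ 1 σ (Icc 0 1) :=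
    ((hγ₁.comp hφ₁.contDiffOn fun t _ => hmem _).add
      (hγ₂.comp hφ₂.contDiffOn fun t _ => hmem _)).sub contDiffOn_const
  have hY : MapsTo σ (Icc 0 1) Y := fun t _ => by
    rcases le_total t (1 / 2) with ht | ht
    · exact hleft t ht ▸ hY₁ (hmem _)
    · exact hright t ht ▸ hY₂ (hmem _)
  have hlen₁ : arcLength c σ 0 (1 / 2) ≤ arcLength c γ₁ 0 1 :=
    (arcLength_congr fun t ht => hleft t ht.2.le).trans_le <|
      arcLength_comp_smoothTransition_le hγ₁.differentiableOn_one (by fun_prop)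
        (fun s t hst => by linarith) fun t ht => ⟨by linarith [ht.1], by linarith [ht.2]⟩
  have hlen₂ : arcLength c σ (1 / 2) 1 ≤ arcLength c γ₂ 0 1 :=
    (arcLength_congr fun t ht => hright t ht.1.le).trans_le <|
      arcLength_comp_smoothTransition_le hγ₂.differentiableOn_one (by fun_prop)
        (fun s t hst => by linarith) fun t ht => ⟨by linarith [ht.1], by linarith [ht.2]⟩
  calc inducedEDist Y c (γ₁ 0) (γ₂ 1) = inducedEDist Y c (σ 0) (σ 1) := by
        rw [hleft 0 (by norm_num), hright 1 (by norm_num)]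
        norm_num [φ₁, φ₂]
    _ ≤ arcLength c σ 0 (1 / 2) + arcLength c σ (1 / 2) 1 :=
        (inducedEDist_le hσ hY).trans arcLength_le_add
    _ ≤ arcLength c γ₁ 0 1 + arcLength c γ₂ 0 1 := add_le_add hlen₁ hlen₂

theorem inducedEDist_triangle :
    inducedEDist Y c x z ≤ inducedEDist Y c x y + inducedEDist Y c y z := by
  rw [← tsub_le_iff_right]
  refine le_inducedEDist fun γ₁ hγ₁ hY₁ hx hy₁ => ?_
  rw [tsub_le_iff_left, add_comm, ← tsub_le_iff_left]
  refine le_inducedEDist fun γ₂ hγ₂ hY₂ hy₂ hz => ?_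
  rw [tsub_le_iff_left, ← hx, ← hz]
  exact inducedEDist_le_arcLength_add_arcLength hγ₁ hγ₂ hY₁ hY₂ (hy₁.trans hy₂.symm)

theorem inducedEDist_map_le {U : Set ℂ} {cU : ℂ → ℝ≥0∞} {g : ℂ → ℂ} (hU : IsOpen U)
    (hg : DifferentiableOn ℂ g U) (hgY : MapsTo g U Y)
    (hle : ∀ z ∈ U, c (g z) ^ (1 / 2 : ℝ) * ‖deriv g z‖ₑ ≤ cU z ^ (1 / 2 : ℝ)) :
    inducedEDist Y c (g x) (g y) ≤ inducedEDist U cU x y := by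
  refine le_inducedEDist fun γ hγ hγU hx hy => ?_
  subst hx hy
  have hgd : ContDiffOn ℝ 1 g U := (hg.contDiffOn hU).restrict_scalars ℝ
  refine (inducedEDist_le (hgd.comp hγ hγU) (hgY.comp hγU)).trans ?_
  refine setLIntegral_mono' measurableSet_Ioo fun t ht => ?_
  have hγt : DifferentiableAt ℝ γ t := (hγ.differentiableOn_one).differentiableAt
    (Icc_mem_nhds ht.1 ht.2)
  have hγtU := hγU (Ioo_subset_Icc_self ht)
  have hgt := hg.differentiableAt (hU.mem_nhds hγtU)
  rw [(hgt.hasDerivAt.comp_of_eq t hγt.hasDerivAt rfl).deriv, enorm_mul, ← mul_assoc,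
    Function.comp_apply]
  gcongr
  exact hle _ hγtU

end InducedDistance

section LengthElements

variable {n : ℕ∞} {r : ℝ} {u v z w : ℂ}

theorem mem_unitDisk : z ∈ unitDisk ↔ ‖z‖ < 1 := mem_ball_zero_iff

theorem isOpen_unitDisk : IsOpen unitDisk := isOpen_ball

theorem four_div_ofReal_sq_rpow_half (hr : 0 ≤ r) :
    (4 / ENNReal.ofReal (r ^ 2)) ^ (1 / 2 : ℝ) = 2 / ENNReal.ofReal r := by
  have h : (4 : ℝ≥0∞) / ENNReal.ofReal (r ^ 2) = (2 / ENNReal.ofReal r) ^ (2 : ℝ) := by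
    rw [ENNReal.div_rpow_of_nonneg _ _ zero_le_two, ENNReal.rpow_two, ENNReal.rpow_two,
      ENNReal.ofReal_pow hr]
    norm_num
  rw [h, ← ENNReal.rpow_mul]
  norm_num

theorem poincareCoeff_rpow_half (hz : ‖z‖ < 1) :
    poincareCoeff z ^ (1 / 2 : ℝ) = 2 / ENNReal.ofReal (1 - ‖z‖ ^ 2) :=
  four_div_ofReal_sq_rpow_half (one_sub_norm_sq_pos hz).le

theorem orbifoldCoeff_eq (n : ℕ∞) (z : ℂ) :
    orbifoldCoeff n z = 4 / ENNReal.ofReal (conformalFactor n ‖z‖ ^ 2) := by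
  cases n with
  | top =>
    change 4 / ENNReal.ofReal (‖z‖ ^ 2 * Real.log (‖z‖ ^ 2) ^ 2) = _
    rw [conformalFactor_top, Real.log_pow]
    congr 2
    push_cast
    ring
  | coe N =>
    have hpow : ‖z‖ ^ (2 - 2 / (N : ℝ)) = (‖z‖ ^ (1 - 1 / (N : ℝ))) ^ 2 := by
      rw [← Real.rpow_mul_natCast (norm_nonneg z)]
      congr 1
      push_cast
      ring
    change 4 / ENNReal.ofReal
      ((N : ℝ) ^ 2 * ‖z‖ ^ (2 - 2 / (N : ℝ)) * (1 - ‖z‖ ^ (2 / (N : ℝ))) ^ 2) = _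
    rw [conformalFactor_natCast, hpow, mul_pow, mul_pow]

theorem orbifoldCoeff_rpow_half (n : ℕ∞) (hz : ‖z‖ ≤ 1) :
    orbifoldCoeff n z ^ (1 / 2 : ℝ) = 2 / ENNReal.ofReal (conformalFactor n ‖z‖) := by
  rw [orbifoldCoeff_eq, four_div_ofReal_sq_rpow_half (conformalFactor_nonneg n (norm_nonneg z) hz)]

theorem two_div_ofReal_mul_enorm_le {a b : ℝ} (hb : 0 < b) (h : ‖u‖ * b ≤ ‖v‖ * a) :
    2 / ENNReal.ofReal a * ‖u‖ₑ ≤ 2 / ENNReal.ofReal b * ‖v‖ₑ := by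
  rcases le_or_gt a 0 with ha | ha
  · have hu : ‖u‖ ≤ 0 :=
      nonpos_of_mul_nonpos_left (h.trans (mul_nonpos_of_nonneg_of_nonpos (norm_nonneg v) ha)) hb
    simp [norm_le_zero_iff.1 hu]
  · have hreal : 2 / a * ‖u‖ ≤ 2 / b * ‖v‖ := by
      rw [div_mul_eq_mul_div, div_mul_eq_mul_div, div_le_div_iff₀ ha hb]
      linarith
    have hof {c : ℝ} (hc : 0 < c) (x : ℂ) :
        2 / ENNReal.ofReal c * ‖x‖ₑ = ENNReal.ofReal (2 / c * ‖x‖) := by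
      rw [ENNReal.ofReal_mul (by positivity), ENNReal.ofReal_div_of_pos hc, ofReal_norm,
        ENNReal.ofReal_ofNat]
    rw [hof ha, hof hb]
    exact ENNReal.ofReal_le_ofReal hreal

theorem poincareEDist_le_of_norm_le (hr : r < 1) (hz : ‖z‖ ≤ r) (hw : ‖w‖ ≤ r) :
    poincareEDist z w ≤ 2 / ENNReal.ofReal (1 - r ^ 2) * ‖w - z‖ₑ := by
  have hseg : ∀ x ∈ segment ℝ z w, ‖x‖ ≤ r := fun x hx => by
    simpa using (convex_closedBall (0 : ℂ) r).segment_subset (by simpa) (by simpa) hx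
  refine inducedEDist_le_mul_enorm_sub (fun x hx => mem_unitDisk.2 ((hseg x hx).trans_lt hr))
    fun x hx => ?_
  rw [poincareCoeff_rpow_half ((hseg x hx).trans_lt hr)]
  gcongr
  exact hseg x hx

theorem poincareEDist_ne_top (hz : z ∈ unitDisk) (hw : w ∈ unitDisk) : poincareEDist z w ≠ ⊤ := by
  rw [mem_unitDisk] at hz hw
  have hr : max ‖z‖ ‖w‖ < 1 := max_lt hz hw
  have hpos : 0 < 1 - max ‖z‖ ‖w‖ ^ 2 := by
    nlinarith [le_max_of_le_left (b := ‖z‖) (c := ‖w‖) (norm_nonneg z)]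
  refine ne_top_of_le_ne_top ?_
    (poincareEDist_le_of_norm_le hr (le_max_left _ _) (le_max_right _ _))
  exact ENNReal.mul_ne_top
    (ENNReal.div_ne_top ENNReal.ofNat_ne_top (ENNReal.ofReal_pos.2 hpos).ne') enorm_ne_top

theorem tendsto_poincareEDist_zero : Tendsto (fun z => poincareEDist z 0) (𝓝 0) (𝓝 0) := by
  set K : ℝ≥0∞ := 2 / ENNReal.ofReal (1 - (1 / 2) ^ 2)
  have hK : K ≠ ⊤ := ENNReal.div_ne_top ENNReal.ofNat_ne_top
    (ENNReal.ofReal_pos.2 (by norm_num)).ne'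
  have hlim : Tendsto (fun z : ℂ => K * ‖0 - z‖ₑ) (𝓝 0) (𝓝 0) := by
    have h : Tendsto (fun z : ℂ => ‖0 - z‖ₑ) (𝓝 0) (𝓝 0) := by
      simpa using (continuous_enorm (E := ℂ)).tendsto 0
    simpa using ENNReal.Tendsto.const_mul h (Or.inr hK)
  refine tendsto_of_tendsto_of_tendsto_of_le_of_le' tendsto_const_nhds hlim
    (Eventually.of_forall fun _ => zero_le) ?_
  filter_upwards [closedBall_mem_nhds (0 : ℂ) one_half_pos] with z hz
  exact poincareEDist_le_of_norm_le one_half_lt_one (mem_closedBall_zero_iff.1 hz) (by simp)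

end LengthElements

section OrbifoldDisk

variable {n : ℕ∞} {hn : 0 < n} {g : ℂ → ℂ} {z p : ℂ}

theorem PlaneOrbifold.IsClassicalOrbifoldMorphism.isOrbifoldMorphism {X : PlaneOrbifold}
    (hg : X.IsClassicalOrbifoldMorphism g) : X.IsOrbifoldMorphism g where
  differentiableOn := hg.differentiableOn
  mapsTo := hg.mapsTo
  not_subset := hg.not_subset
  le_order p hp hp_top x hx hgx := by
    obtain ⟨k, hk⟩ := hg.dvd_order p hp hp_top x hx hgx
    have han : AnalyticAt ℂ (fun t => g t - p) x :=
      (hg.differentiableOn.analyticAt (isOpen_unitDisk.mem_nhds hx)).fun_sub analyticAt_const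
    have hord : analyticOrderAt (fun t => g t - p) x ≠ 0 :=
      han.analyticOrderAt_ne_zero.2 (sub_eq_zero.2 hgx)
    have hk0 : k ≠ 0 := fun h => hord (by rw [hk, h, mul_zero])
    exact hk ▸ le_mul_of_one_le_right zero_le (Order.one_le_iff_ne_zero.2 hk0)
  avoids := hg.avoids

theorem orbifoldDisk_mult_zero : (orbifoldDisk n hn).mult 0 = n := if_pos rfl

theorem orbifoldDisk_mult_of_ne_zero (hp : p ≠ 0) : (orbifoldDisk n hn).mult p = 1 := if_neg hp

theorem eq_zero_of_mem_orbifoldDisk_supp (hp : p ∈ (orbifoldDisk n hn).supp) : p = 0 := by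
  by_contra h
  exact hp (orbifoldDisk_mult_of_ne_zero h)

theorem zero_mem_orbifoldDisk_supp (h : n ≠ 1) : (0 : ℂ) ∈ (orbifoldDisk n hn).supp := by
  rwa [PlaneOrbifold.supp, mem_ofPred_eq, orbifoldDisk_mult_zero]

theorem zero_notMem_orbifoldDisk_top (hn : (0 : ℕ∞) < ⊤) :
    (0 : ℂ) ∉ (orbifoldDisk ⊤ hn).carrier \ (orbifoldDisk ⊤ hn).deltaOne :=
  fun h => h.2 orbifoldDisk_mult_zero

theorem isClassicalOrbifoldMorphism_of_dvd_analyticOrderAt (hg : DifferentiableOn ℂ g unitDisk)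
    (hg₁ : MapsTo g unitDisk unitDisk) (hne : ∃ z ∈ unitDisk, g z ≠ 0)
    (hord : ∀ z ∈ unitDisk, g z = 0 → n ≠ ⊤ ∧ n ∣ analyticOrderAt g z) :
    (orbifoldDisk n hn).IsClassicalOrbifoldMorphism g where
  differentiableOn := hg
  mapsTo := hg₁
  not_subset h := by
    obtain ⟨z, hz, hgz⟩ := hne
    exact hgz (eq_zero_of_mem_orbifoldDisk_supp (h (mem_image_of_mem g hz)))
  dvd_order p hp _ x hx hgx := by
    obtain rfl := eq_zero_of_mem_orbifoldDisk_supp hp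
    simpa only [sub_zero, orbifoldDisk_mult_zero] using (hord x hx hgx).2
  avoids p hp x hx hgx := by
    obtain rfl | hp₀ := eq_or_ne p 0
    · exact (hord x hx hgx).1 (orbifoldDisk_mult_zero.symm.trans hp)
    · rw [orbifoldDisk_mult_of_ne_zero hp₀] at hp
      exact ENat.one_ne_top hp

theorem le_analyticOrderAt_of_isOrbifoldMorphism (hg : (orbifoldDisk n hn).IsOrbifoldMorphism g)
    (hz : z ∈ unitDisk) (hgz : g z = 0) : n ≤ analyticOrderAt g z := by
  have hn_top : n ≠ ⊤ := fun h => hg.avoids 0 (orbifoldDisk_mult_zero.trans h) z hz hgz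
  rcases eq_or_ne n 1 with rfl | hn₁
  · have han := hg.differentiableOn.analyticAt (isOpen_unitDisk.mem_nhds hz)
    exact Order.one_le_iff_ne_zero.2 (han.analyticOrderAt_ne_zero.2 hgz)
  · have hord := hg.le_order 0 (zero_mem_orbifoldDisk_supp hn₁)
      (orbifoldDisk_mult_zero.trans_ne hn_top) z hz hgz
    simpa only [sub_zero, orbifoldDisk_mult_zero] using hord

theorem orbifoldCoeff_rpow_half_mul_enorm_deriv_le
    (hg : (orbifoldDisk n hn).IsOrbifoldMorphism g) (hz : z ∈ unitDisk) :
    orbifoldCoeff n (g z) ^ (1 / 2 : ℝ) * ‖deriv g z‖ₑ ≤ poincareCoeff z ^ (1 / 2 : ℝ) := by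
  have hz₁ := mem_unitDisk.1 hz
  have hle := norm_deriv_mul_le_conformalFactor hn.ne' hg.differentiableOn hg.mapsTo
    (fun w hw => le_analyticOrderAt_of_isOrbifoldMorphism hg hw) hz₁
  rw [orbifoldCoeff_rpow_half n (mem_unitDisk.1 (hg.mapsTo hz)).le, poincareCoeff_rpow_half hz₁]
  simpa using two_div_ofReal_mul_enorm_le (v := 1) (one_sub_norm_sq_pos hz₁) (by simpa using hle)

end OrbifoldDisk

section Covering

variable {n : ℕ∞} {z ζ : ℂ}

/-- The map `D → D` that is an orbifold universal covering of the orbifold disk: the `N`-th power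
map for finite `n = N`, and the exponential composed with a Cayley transform for `n = ∞`. -/
def diskCovering : ℕ∞ → ℂ → ℂ
  | (N : ℕ), z => z ^ N
  | ⊤, z => Complex.exp ((z + 1) / (z - 1))

/-- The lift through `diskCovering n` of the exponential map on the left half-plane. -/
def diskLift : ℕ∞ → ℂ → ℂ
  | (N : ℕ), ζ => Complex.exp (ζ / N)
  | ⊤, ζ => (ζ + 1) / (ζ - 1)

theorem diskCovering_natCast (N : ℕ) : diskCovering N = fun z => z ^ N := rfl

theorem diskCovering_top : diskCovering ⊤ = fun z => Complex.exp ((z + 1) / (z - 1)) := rfl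

theorem diskLift_natCast (N : ℕ) : diskLift N = fun ζ => Complex.exp (ζ / N) := rfl

theorem diskLift_top : diskLift ⊤ = fun ζ => (ζ + 1) / (ζ - 1) := rfl

theorem sub_one_ne_zero_of_mem_unitDisk (hz : z ∈ unitDisk) : z - 1 ≠ 0 := fun h => by
  simp [mem_unitDisk, sub_eq_zero.1 h] at hz

theorem sub_one_ne_zero_of_re_neg (hζ : ζ.re < 0) : ζ - 1 ≠ 0 := fun h => by
  norm_num [sub_eq_zero.1 h] at hζ

theorem re_add_one_div_sub_one_neg (hz : z ∈ unitDisk) : ((z + 1) / (z - 1)).re < 0 := by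
  have hre : ((z + 1) / (z - 1)).re = (‖z‖ ^ 2 - 1) / ‖z - 1‖ ^ 2 := by
    rw [Complex.div_re, Complex.sq_norm, Complex.sq_norm, ← add_div]
    congr 1
    simp only [Complex.normSq_apply, Complex.add_re, Complex.add_im, Complex.sub_re,
      Complex.sub_im, Complex.one_re, Complex.one_im]
    ring
  rw [hre]
  exact div_neg_of_neg_of_pos (by linarith [one_sub_norm_sq_pos (mem_unitDisk.1 hz)])
    (pow_pos (norm_pos_iff.2 (sub_one_ne_zero_of_mem_unitDisk hz)) 2)

theorem one_sub_norm_sq_add_one_div_sub_one (hζ : ζ ≠ 1) :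
    1 - ‖(ζ + 1) / (ζ - 1)‖ ^ 2 = -4 * ζ.re / ‖ζ - 1‖ ^ 2 := by
  have hpos : 0 < ‖ζ - 1‖ := norm_pos_iff.2 (sub_ne_zero.2 hζ)
  rw [norm_div, div_pow, eq_div_iff (by positivity), sub_mul, div_mul_cancel₀ _ (by positivity),
    Complex.sq_norm, Complex.sq_norm]
  simp only [Complex.normSq_apply, Complex.add_re, Complex.add_im, Complex.sub_re,
    Complex.sub_im, Complex.one_re, Complex.one_im]
  ring

theorem half_mem_unitDisk : (1 / 2 : ℂ) ∈ unitDisk := by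
  norm_num [mem_unitDisk]

theorem isClassicalOrbifoldMorphism_diskCovering (n : ℕ∞) (hn : 0 < n) :
    (orbifoldDisk n hn).IsClassicalOrbifoldMorphism (diskCovering n) := by
  cases n with
  | top =>
    rw [diskCovering_top]
    refine isClassicalOrbifoldMorphism_of_dvd_analyticOrderAt (fun z hz => ?_) (fun z hz => ?_)
      ⟨_, half_mem_unitDisk, Complex.exp_ne_zero _⟩ fun z _ h => absurd h (Complex.exp_ne_zero _)
    · have := sub_one_ne_zero_of_mem_unitDisk hz
      exact DifferentiableAt.differentiableWithinAt (by fun_prop (disch := assumption))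
    · rw [mem_unitDisk, Complex.norm_exp, Real.exp_lt_one_iff]
      exact re_add_one_div_sub_one_neg hz
  | coe N =>
    have hN : N ≠ 0 := by exact_mod_cast hn.ne'
    rw [diskCovering_natCast]
    refine isClassicalOrbifoldMorphism_of_dvd_analyticOrderAt (by fun_prop) (fun z hz => ?_)
      ⟨_, half_mem_unitDisk, by simp⟩ fun z _ h => ⟨ENat.natCast_ne_top N, ?_⟩
    · rw [mem_unitDisk] at hz ⊢
      rw [norm_pow]
      exact pow_lt_one₀ (norm_nonneg z) hz hN
    · obtain rfl := eq_zero_of_pow_eq_zero h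
      have hord : analyticOrderAt (fun z : ℂ => z ^ N) 0 = N := by
        simpa [Pi.pow_def] using analyticOrderAt_centeredMonomial (z₀ := (0 : ℂ)) (n := N)
      rw [hord]

theorem differentiableOn_diskLift (n : ℕ∞) : DifferentiableOn ℂ (diskLift n) {ζ | ζ.re < 0} := by
  cases n with
  | top =>
    rw [diskLift_top]
    intro ζ hζ
    have := sub_one_ne_zero_of_re_neg hζ
    exact DifferentiableAt.differentiableWithinAt (by fun_prop (disch := assumption))
  | coe N =>
    rw [diskLift_natCast]
    fun_prop

theorem mapsTo_diskLift (hn : n ≠ 0) : MapsTo (diskLift n) {ζ | ζ.re < 0} unitDisk := by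
  intro ζ hζ
  rw [mem_ofPred_eq] at hζ
  cases n with
  | top =>
    have hne := sub_ne_zero.1 (sub_one_ne_zero_of_re_neg hζ)
    have hpos : 0 < 1 - ‖diskLift ⊤ ζ‖ ^ 2 := by
      rw [diskLift_top, one_sub_norm_sq_add_one_div_sub_one hne]
      exact div_pos (by linarith) (pow_pos (norm_pos_iff.2 (sub_ne_zero.2 hne)) 2)
    exact mem_unitDisk.2 ((sq_lt_one_iff₀ (norm_nonneg _)).1 (sub_pos.1 hpos))
  | coe N =>
    have hN : (0 : ℝ) < N := Nat.cast_pos.2 (Nat.pos_of_ne_zero (by exact_mod_cast hn))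
    rw [diskLift_natCast, mem_unitDisk, Complex.norm_exp, Real.exp_lt_one_iff,
      Complex.div_natCast_re]
    exact div_neg_of_neg_of_pos hζ hN

theorem diskCovering_diskLift (hn : n ≠ 0) (hζ : ζ.re < 0) :
    diskCovering n (diskLift n ζ) = Complex.exp ζ := by
  cases n with
  | top =>
    have hne := sub_one_ne_zero_of_re_neg hζ
    have hsub : (ζ + 1) / (ζ - 1) - 1 = 2 / (ζ - 1) := by field_simp; ring
    have hadd : (ζ + 1) / (ζ - 1) + 1 = 2 * ζ / (ζ - 1) := by field_simp; ring
    rw [diskCovering_top, diskLift_top]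
    dsimp only
    rw [hsub, hadd]
    field_simp
  | coe N =>
    have hN : (N : ℂ) ≠ 0 := by exact_mod_cast hn
    rw [diskCovering_natCast, diskLift_natCast]
    dsimp only
    rw [← Complex.exp_nat_mul, mul_div_cancel₀ _ hN]

theorem norm_deriv_diskLift_mul_conformalFactor (hn : n ≠ 0) (hζ : ζ.re < 0) :
    ‖deriv (diskLift n) ζ‖ * conformalFactor n (Real.exp ζ.re) =
      Real.exp ζ.re * (1 - ‖diskLift n ζ‖ ^ 2) := by
  cases n with
  | top =>
    have hne := sub_one_ne_zero_of_re_neg hζ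
    have hder : HasDerivAt (diskLift ⊤) (-2 / (ζ - 1) ^ 2) ζ := by
      convert! ((hasDerivAt_id ζ).add_const 1).div ((hasDerivAt_id ζ).sub_const 1) hne using 2
      simp only [id_eq]
      ring
    rw [hder.deriv, conformalFactor_top, Real.log_exp, diskLift_top,
      one_sub_norm_sq_add_one_div_sub_one (sub_ne_zero.1 hne), norm_div, norm_neg, norm_pow,
      Complex.norm_ofNat]
    ring
  | coe N =>
    have hN : (N : ℝ) ≠ 0 := by exact_mod_cast hn
    have hder : HasDerivAt (diskLift N) (Complex.exp (ζ / N) * (1 / N)) ζ :=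
      ((hasDerivAt_id ζ).div_const (N : ℂ)).cexp
    rw [hder.deriv, conformalFactor_natCast, diskLift_natCast, norm_mul, Complex.norm_exp,
      Complex.div_natCast_re, ← Real.exp_mul, ← Real.exp_mul, ← Real.exp_nat_mul, norm_div,
      norm_one, Complex.norm_natCast]
    have hexp : Real.exp (ζ.re / N) * Real.exp (ζ.re * (1 - 1 / N)) = Real.exp ζ.re := by
      rw [← Real.exp_add]
      congr 1
      ring
    have hsq : ζ.re * (2 / N) = (2 : ℕ) * (ζ.re / N) := by push_cast; ring
    rw [hsq, ← hexp]
    field_simp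

end Covering

section Maximality

variable {n : ℕ∞} {hn : 0 < n} {d : (orbifoldDisk n hn).Points → (orbifoldDisk n hn).Points → ℝ}
  {x y o : (orbifoldDisk n hn).Points} {γ l : ℝ → ℂ} {a b : ℝ}

theorem arcLength_diskLift_comp_le (hn : n ≠ 0) (hl : Differentiable ℝ l)
    (hre : ∀ t ∈ Ioo a b, (l t).re < 0) :
    arcLength poincareCoeff (diskLift n ∘ l) a b ≤
      arcLength (orbifoldCoeff n) (fun t => Complex.exp (l t)) a b := by
  refine setLIntegral_mono' measurableSet_Ioo fun t ht => ?_
  have hret := hre t ht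
  have hexp : Real.exp (l t).re < 1 := Real.exp_lt_one_iff.2 hret
  have hlift := (differentiableOn_diskLift n).differentiableAt
    ((isOpen_lt Complex.continuous_re continuous_const).mem_nhds hret)
  have hder₁ := (hlift.hasDerivAt.comp_of_eq t (hl t).hasDerivAt rfl).deriv
  have hder₂ := (hl t).hasDerivAt.cexp.deriv
  rw [Function.comp_apply, orbifoldCoeff_rpow_half n (by rw [Complex.norm_exp]; exact hexp.le),
    poincareCoeff_rpow_half (mem_unitDisk.1 (mapsTo_diskLift hn hret)), Complex.norm_exp]
  refine two_div_ofReal_mul_enorm_le (conformalFactor_pos hn (Real.exp_pos _) hexp) (le_of_eq ?_)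
  rw [hder₁, hder₂, norm_mul, norm_mul, Complex.norm_exp, mul_right_comm,
    norm_deriv_diskLift_mul_conformalFactor hn hret]
  ring

theorem exists_contDiff_exp_eq (hab : a < b) (hγ : ContDiffOn ℝ 1 γ (Icc a b))
    (hγ₀ : ∀ t ∈ Icc a b, γ t ≠ 0) :
    ∃ l : ℝ → ℂ, ContDiff ℝ 1 l ∧ ∀ t ∈ Icc a b, Complex.exp (l t) = γ t := by
  set f : ℝ → ℂ := fun t => derivWithin γ (Icc a b) t / γ t
  have hf : ContinuousOn f (Icc a b) :=
    (hγ.continuousOn_derivWithin (uniqueDiffOn_Icc hab) le_rfl).div hγ.continuousOn hγ₀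
  set F : ℝ → ℂ := IccExtend hab.le ((Icc a b).domRestrict f)
  have hF : Continuous F := (continuousOn_iff_continuous_domRestrict.1 hf).Icc_extend'
  have hFf : ∀ t ∈ Icc a b, F t = f t := fun t ht => IccExtend_of_mem hab.le _ ht
  set l : ℝ → ℂ := fun t => Complex.log (γ a) + ∫ s in a..t, F s
  have hl (t : ℝ) : HasDerivAt l (F t) t :=
    (hF.integral_hasStrictDerivAt a t).hasDerivAt.const_add _
  have hconst : ∀ t ∈ Icc a b, HasDerivWithinAt (fun t => γ t * Complex.exp (-l t)) 0
      (Icc a b) t := fun t ht => by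
    convert! (hγ.differentiableOn_one t ht).hasDerivWithinAt.mul (hl t).neg.cexp.hasDerivWithinAt
      using 1
    rw [hFf t ht]
    simp only [f]
    field_simp [hγ₀ t ht]
    ring
  refine ⟨l, contDiff_one_iff_deriv.2 ⟨fun t => (hl t).differentiableAt, ?_⟩, fun t ht => ?_⟩
  · rwa [funext fun t => (hl t).deriv]
  · have ha : a ∈ Icc a b := left_mem_Icc.2 hab.le
    have heq := constant_of_derivWithin_zero (fun t ht => (hconst t ht).differentiableWithinAt)
      (fun t ht => (hconst t (Ico_subset_Icc_self ht)).derivWithin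
        (uniqueDiffOn_Icc hab t (Ico_subset_Icc_self ht))) t ht
    have hla : l a = Complex.log (γ a) := by simp [l]
    rw [hla, Complex.exp_neg, Complex.exp_neg, Complex.exp_log (hγ₀ a ha),
      mul_inv_cancel₀ (hγ₀ a ha), mul_inv_eq_one₀ (Complex.exp_ne_zero _)] at heq
    exact heq.symm

theorem ofReal_le_poincareEDist_of_diskCovering_eq
    (hd : d ∈ (orbifoldDisk n hn).classicalDecreasingPseudoDists) {z w : ℂ} (hz : z ∈ unitDisk)
    (hw : w ∈ unitDisk) (hx : diskCovering n z = x) (hy : diskCovering n w = y) :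
    ENNReal.ofReal (d x y) ≤ poincareEDist z w := by
  have hcov := isClassicalOrbifoldMorphism_diskCovering n hn
  obtain rfl : x = ⟨diskCovering n z, hcov.mem hz⟩ := Subtype.ext hx.symm
  obtain rfl : y = ⟨diskCovering n w, hcov.mem hw⟩ := Subtype.ext hy.symm
  exact hd.2 _ hcov z w hz hw

theorem ofReal_le_arcLength_of_ne_zero
    (hd : d ∈ (orbifoldDisk n hn).classicalDecreasingPseudoDists) (hab : a < b)
    (hγ : ContDiffOn ℝ 1 γ (Icc a b)) (hγD : MapsTo γ (Icc a b) unitDisk)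
    (hγ₀ : ∀ t ∈ Icc a b, γ t ≠ 0) (hx : γ a = x) (hy : γ b = y) :
    ENNReal.ofReal (d x y) ≤ arcLength (orbifoldCoeff n) γ a b := by
  obtain ⟨l, hl, hexp⟩ := exists_contDiff_exp_eq hab hγ hγ₀
  have hre : MapsTo l (Icc a b) {ζ | ζ.re < 0} := fun t ht => by
    have hmem := hγD ht
    rwa [← hexp t ht, mem_unitDisk, Complex.norm_exp, Real.exp_lt_one_iff] at hmem
  have hopen : IsOpen {ζ : ℂ | ζ.re < 0} := isOpen_lt Complex.continuous_re continuous_const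
  have hη : ContDiffOn ℝ 1 (diskLift n ∘ l) (Icc a b) :=
    (((differentiableOn_diskLift n).contDiffOn hopen).restrict_scalars ℝ).comp hl.contDiffOn hre
  have hηD : MapsTo (diskLift n ∘ l) (Icc a b) unitDisk := (mapsTo_diskLift hn.ne').comp hre
  have hcov : ∀ t ∈ Icc a b, diskCovering n ((diskLift n ∘ l) t) = γ t := fun t ht =>
    (diskCovering_diskLift hn.ne' (hre ht)).trans (hexp t ht)
  have ha : a ∈ Icc a b := left_mem_Icc.2 hab.le
  have hb : b ∈ Icc a b := right_mem_Icc.2 hab.le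
  calc ENNReal.ofReal (d x y)
      ≤ poincareEDist ((diskLift n ∘ l) a) ((diskLift n ∘ l) b) :=
        ofReal_le_poincareEDist_of_diskCovering_eq hd (hηD ha) (hηD hb) ((hcov a ha).trans hx)
          ((hcov b hb).trans hy)
    _ ≤ arcLength poincareCoeff (diskLift n ∘ l) a b := inducedEDist_le_arcLength hab hη hηD
    _ ≤ arcLength (orbifoldCoeff n) (fun t => Complex.exp (l t)) a b :=
        arcLength_diskLift_comp_le hn.ne' (hl.differentiable one_ne_zero) fun t ht =>
          hre (Ioo_subset_Icc_self ht)
    _ = arcLength (orbifoldCoeff n) γ a b :=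
        arcLength_congr fun t ht => hexp t (Ioo_subset_Icc_self ht)

theorem tendsto_ofReal_dist_of_eq_zero
    (hd : d ∈ (orbifoldDisk n hn).classicalDecreasingPseudoDists) (ho : (o : ℂ) = 0) :
    Tendsto (fun u => ENNReal.ofReal (d u o)) (𝓝 o) (𝓝 0) := by
  cases n with
  | top => exact absurd (ho ▸ o.2) (zero_notMem_orbifoldDisk_top hn)
  | coe N =>
    have hN : N ≠ 0 := by exact_mod_cast hn.ne'
    have hroot : Tendsto (fun u : (orbifoldDisk N hn).Points => (u : ℂ) ^ (N⁻¹ : ℂ))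
        (𝓝 o) (𝓝 0) := by
      have hcont : ContinuousAt (fun u : ℂ => u ^ (N⁻¹ : ℂ)) 0 :=
        Complex.continuousAt_cpow_const_of_re_pos (by simp) (by
          rw [← Complex.ofReal_natCast, ← Complex.ofReal_inv, Complex.ofReal_re]
          positivity)
      have hlim := hcont.tendsto.comp (ho ▸ continuous_subtype_val.tendsto o)
      rwa [Complex.zero_cpow (by simpa using hN)] at hlim
    refine tendsto_of_tendsto_of_tendsto_of_le_of_le tendsto_const_nhds
      (tendsto_poincareEDist_zero.comp hroot) (fun _ => zero_le) fun u => ?_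
    have hpow : ((u : ℂ) ^ (N⁻¹ : ℂ)) ^ N = u := Complex.cpow_nat_inv_pow u hN
    have hmem : (u : ℂ) ^ (N⁻¹ : ℂ) ∈ unitDisk := by
      rw [mem_unitDisk, ← pow_lt_one_iff_of_nonneg (norm_nonneg _) hN, ← norm_pow, hpow]
      exact mem_unitDisk.1 u.2.1
    exact ofReal_le_poincareEDist_of_diskCovering_eq hd hmem (mem_unitDisk.2 (by simp)) hpow
      ((zero_pow hN).trans ho.symm)

theorem ofReal_le_of_eventually_of_tendsto_zero
    (hd : d ∈ (orbifoldDisk n hn).classicalDecreasingPseudoDists) (ho : (o : ℂ) = 0) {F : Filter ℝ}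
    [F.NeBot] (hγ : Tendsto γ F (𝓝 0)) {L : ℝ≥0∞}
    (hL : ∀ᶠ t in F, ∃ u : (orbifoldDisk n hn).Points, u = γ t ∧ ENNReal.ofReal (d x u) ≤ L) :
    ENNReal.ofReal (d x o) ≤ L := by
  have hfreq : ∃ᶠ u in 𝓝 o, ENNReal.ofReal (d x u) ≤ L := by
    rw [nhds_subtype, frequently_comap, ho]
    exact hγ.frequently hL.frequently
  have hlim : Tendsto (fun u => L + ENNReal.ofReal (d u o)) (𝓝 o) (𝓝 L) := by
    simpa using (tendsto_const_nhds (x := L)).add (tendsto_ofReal_dist_of_eq_zero hd ho)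
  refine ge_of_tendsto_of_frequently hlim (hfreq.mono fun u hu => ?_)
  calc ENNReal.ofReal (d x o) ≤ ENNReal.ofReal (d x u + d u o) :=
        ENNReal.ofReal_le_ofReal (hd.1.triangle x u o)
    _ ≤ ENNReal.ofReal (d x u) + ENNReal.ofReal (d u o) := ENNReal.ofReal_add_le
    _ ≤ L + ENNReal.ofReal (d u o) := by gcongr

theorem ofReal_le_arcLength_of_right_eq_zero
    (hd : d ∈ (orbifoldDisk n hn).classicalDecreasingPseudoDists) (hab : a ≤ b)
    (hγ : ContDiffOn ℝ 1 γ (Icc a b))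
    (hγY : MapsTo γ (Icc a b) ((orbifoldDisk n hn).carrier \ (orbifoldDisk n hn).deltaOne))
    (hγ₀ : ∀ t ∈ Ico a b, γ t ≠ 0) (hx : γ a = x) (hb : γ b = 0) (ho : (o : ℂ) = 0) :
    ENNReal.ofReal (d x o) ≤ arcLength (orbifoldCoeff n) γ a b := by
  rcases hab.eq_or_lt with rfl | hlt
  · obtain rfl : x = o := Subtype.ext (hx.symm.trans (hb.trans ho.symm))
    simp [hd.1.self]
  have hlim : Tendsto γ (𝓝[<] b) (𝓝 0) := by
    have hcont := (hγ.continuousOn b (right_mem_Icc.2 hab)).tendsto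
    rw [hb] at hcont
    exact hcont.mono_left
      (nhdsWithin_Ioo_eq_nhdsLT hlt ▸ nhdsWithin_mono b Ioo_subset_Icc_self)
  refine ofReal_le_of_eventually_of_tendsto_zero hd ho hlim ?_
  filter_upwards [Ioo_mem_nhdsLT hlt] with t ht
  have hsub : Icc a t ⊆ Icc a b := Icc_subset_Icc_right ht.2.le
  refine ⟨⟨γ t, hγY (Ioo_subset_Icc_self ht)⟩, rfl, ?_⟩
  calc ENNReal.ofReal (d x ⟨γ t, _⟩) ≤ arcLength (orbifoldCoeff n) γ a t :=
        ofReal_le_arcLength_of_ne_zero hd ht.1 (hγ.mono hsub) (fun s hs => (hγY (hsub hs)).1)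
          (fun s hs => hγ₀ s ⟨hs.1, hs.2.trans_lt ht.2⟩) hx rfl
    _ ≤ arcLength (orbifoldCoeff n) γ a b := arcLength_mono (Ioo_subset_Ioo_right ht.2.le)

theorem ofReal_le_arcLength_of_left_eq_zero
    (hd : d ∈ (orbifoldDisk n hn).classicalDecreasingPseudoDists) (hab : a ≤ b)
    (hγ : ContDiffOn ℝ 1 γ (Icc a b))
    (hγY : MapsTo γ (Icc a b) ((orbifoldDisk n hn).carrier \ (orbifoldDisk n hn).deltaOne))
    (hγ₀ : ∀ t ∈ Ioc a b, γ t ≠ 0) (ha : γ a = 0) (hy : γ b = y) (ho : (o : ℂ) = 0) :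
    ENNReal.ofReal (d o y) ≤ arcLength (orbifoldCoeff n) γ a b := by
  rcases hab.eq_or_lt with rfl | hlt
  · obtain rfl : y = o := Subtype.ext (hy.symm.trans (ha.trans ho.symm))
    simp [hd.1.self]
  have hlim : Tendsto γ (𝓝[>] a) (𝓝 0) := by
    have hcont := (hγ.continuousOn a (left_mem_Icc.2 hab)).tendsto
    rw [ha] at hcont
    exact hcont.mono_left
      (nhdsWithin_Ioo_eq_nhdsGT hlt ▸ nhdsWithin_mono a Ioo_subset_Icc_self)
  rw [hd.1.symm o y]
  refine ofReal_le_of_eventually_of_tendsto_zero hd ho hlim ?_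
  filter_upwards [Ioo_mem_nhdsGT hlt] with t ht
  have hsub : Icc t b ⊆ Icc a b := Icc_subset_Icc_left ht.1.le
  refine ⟨⟨γ t, hγY (Ioo_subset_Icc_self ht)⟩, rfl, ?_⟩
  rw [hd.1.symm y]
  calc ENNReal.ofReal (d ⟨γ t, _⟩ y) ≤ arcLength (orbifoldCoeff n) γ t b :=
        ofReal_le_arcLength_of_ne_zero hd ht.2 (hγ.mono hsub) (fun s hs => (hγY (hsub hs)).1)
          (fun s hs => hγ₀ s ⟨ht.1.trans_le hs.1, hs.2⟩) rfl hy
    _ ≤ arcLength (orbifoldCoeff n) γ a b := arcLength_mono (Ioo_subset_Ioo_left ht.1.le)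

theorem ofReal_le_arcLength (hd : d ∈ (orbifoldDisk n hn).classicalDecreasingPseudoDists)
    (hab : a < b) (hγ : ContDiffOn ℝ 1 γ (Icc a b))
    (hγY : MapsTo γ (Icc a b) ((orbifoldDisk n hn).carrier \ (orbifoldDisk n hn).deltaOne))
    (hx : γ a = x) (hy : γ b = y) :
    ENNReal.ofReal (d x y) ≤ arcLength (orbifoldCoeff n) γ a b := by
  rcases (Icc a b ∩ γ ⁻¹' {0}).eq_empty_or_nonempty with hempty | hne
  · exact ofReal_le_arcLength_of_ne_zero hd hab hγ (fun t ht => (hγY ht).1)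
      (fun t ht hzero => hempty.subset ⟨ht, hzero⟩) hx hy
  have hcompact : IsCompact (Icc a b ∩ γ ⁻¹' {0}) :=
    isCompact_Icc.of_isClosed_subset
      (hγ.continuousOn.preimage_isClosed_of_isClosed isClosed_Icc isClosed_singleton)
      inter_subset_left
  obtain ⟨s, ⟨hs, hγs⟩, hfirst⟩ := hcompact.exists_isLeast hne
  obtain ⟨t, ⟨ht, hγt⟩, hlast⟩ := hcompact.exists_isGreatest hne
  rw [mem_preimage, mem_singleton_iff] at hγs hγt
  have hst : s ≤ t := hlast ⟨hs, hγs⟩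
  set o : (orbifoldDisk n hn).Points := ⟨γ s, hγY hs⟩
  have hsubs : Icc a s ⊆ Icc a b := Icc_subset_Icc_right hs.2
  have hsubt : Icc t b ⊆ Icc a b := Icc_subset_Icc_left ht.1
  have hxo : ENNReal.ofReal (d x o) ≤ arcLength (orbifoldCoeff n) γ a s :=
    ofReal_le_arcLength_of_right_eq_zero hd hs.1 (hγ.mono hsubs) (hγY.mono_left hsubs)
      (fun r hr hzero => hr.2.not_ge (hfirst ⟨hsubs (Ico_subset_Icc_self hr), hzero⟩)) hx hγs hγs
  have hoy : ENNReal.ofReal (d o y) ≤ arcLength (orbifoldCoeff n) γ t b :=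
    ofReal_le_arcLength_of_left_eq_zero hd ht.2 (hγ.mono hsubt) (hγY.mono_left hsubt)
      (fun r hr hzero => hr.1.not_ge (hlast ⟨hsubt (Ioc_subset_Icc_self hr), hzero⟩)) hγt hy hγs
  calc ENNReal.ofReal (d x y) ≤ ENNReal.ofReal (d x o + d o y) :=
        ENNReal.ofReal_le_ofReal (hd.1.triangle x o y)
    _ ≤ ENNReal.ofReal (d x o) + ENNReal.ofReal (d o y) := ENNReal.ofReal_add_le
    _ ≤ arcLength (orbifoldCoeff n) γ a s + arcLength (orbifoldCoeff n) γ s b :=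
        add_le_add hxo (hoy.trans (arcLength_mono (Ioo_subset_Ioo_left hst)))
    _ ≤ arcLength (orbifoldCoeff n) γ a b := arcLength_add_le hs.1 hs.2

end Maximality

section Kobayashi

variable {n : ℕ∞} {hn : 0 < n} {d : (orbifoldDisk n hn).Points → (orbifoldDisk n hn).Points → ℝ}

/-- The distance on the points of the orbifold disk induced by the metric `orbifoldCoeff n`. -/
def orbifoldEDist (n : ℕ∞) (hn : 0 < n) (x y : (orbifoldDisk n hn).Points) : ℝ≥0∞ :=
  inducedEDist ((orbifoldDisk n hn).carrier \ (orbifoldDisk n hn).deltaOne) (orbifoldCoeff n) x y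

theorem ofReal_le_orbifoldEDist (hd : d ∈ (orbifoldDisk n hn).classicalDecreasingPseudoDists)
    (x y : (orbifoldDisk n hn).Points) : ENNReal.ofReal (d x y) ≤ orbifoldEDist n hn x y :=
  le_inducedEDist fun _ hγ hγY hx hy => ofReal_le_arcLength hd zero_lt_one hγ hγY hx hy

theorem orbifoldEDist_map_le {g : ℂ → ℂ} (hg : (orbifoldDisk n hn).IsOrbifoldMorphism g)
    {z w : ℂ} (hz : z ∈ unitDisk) (hw : w ∈ unitDisk) :
    orbifoldEDist n hn ⟨g z, hg.mem hz⟩ ⟨g w, hg.mem hw⟩ ≤ poincareEDist z w :=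
  inducedEDist_map_le isOpen_unitDisk hg.differentiableOn (fun _ h => hg.mem h)
    fun _ h => orbifoldCoeff_rpow_half_mul_enorm_deriv_le hg h

theorem exists_diskCovering_eq (x : (orbifoldDisk n hn).Points) :
    ∃ z ∈ unitDisk, diskCovering n z = x := by
  by_cases hx : (x : ℂ) = 0
  · cases n with
    | top => exact absurd (hx ▸ x.2) (zero_notMem_orbifoldDisk_top hn)
    | coe N => exact ⟨0, mem_unitDisk.2 (by simp),
        (zero_pow (by exact_mod_cast hn.ne' : N ≠ 0)).trans hx.symm⟩
  · have hlog : (Complex.log x).re < 0 := by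
      rw [Complex.log_re]
      exact Real.log_neg (norm_pos_iff.2 hx) (mem_unitDisk.1 x.2.1)
    exact ⟨diskLift n (Complex.log x), mapsTo_diskLift hn.ne' hlog,
      (diskCovering_diskLift hn.ne' hlog).trans (Complex.exp_log hx)⟩

theorem orbifoldEDist_ne_top (x y : (orbifoldDisk n hn).Points) : orbifoldEDist n hn x y ≠ ⊤ := by
  have hcov := (isClassicalOrbifoldMorphism_diskCovering n hn).isOrbifoldMorphism
  obtain ⟨z, hz, hzx⟩ := exists_diskCovering_eq x
  obtain ⟨w, hw, hwy⟩ := exists_diskCovering_eq y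
  obtain rfl : x = ⟨diskCovering n z, hcov.mem hz⟩ := Subtype.ext hzx.symm
  obtain rfl : y = ⟨diskCovering n w, hcov.mem hw⟩ := Subtype.ext hwy.symm
  exact ne_top_of_le_ne_top (poincareEDist_ne_top hz hw) (orbifoldEDist_map_le hcov hz hw)

theorem isPseudoDist_toReal_orbifoldEDist :
    IsPseudoDist fun x y => (orbifoldEDist n hn x y).toReal where
  nonneg _ _ := ENNReal.toReal_nonneg
  self x := by rw [orbifoldEDist, inducedEDist_self x.2, ENNReal.toReal_zero]
  symm x y := by rw [orbifoldEDist, inducedEDist_comm, orbifoldEDist]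
  triangle x y z := by
    have hxy := orbifoldEDist_ne_top x y
    have hyz := orbifoldEDist_ne_top y z
    rw [← ENNReal.toReal_add hxy hyz]
    exact ENNReal.toReal_mono (ENNReal.add_ne_top.2 ⟨hxy, hyz⟩) inducedEDist_triangle

theorem PlaneOrbifold.decreasingPseudoDists_subset_classicalDecreasingPseudoDists
    (X : PlaneOrbifold) : X.decreasingPseudoDists ⊆ X.classicalDecreasingPseudoDists :=
  fun _ hd => ⟨hd.1, fun g hg z w hz hw => hd.2 g hg.isOrbifoldMorphism z w hz hw⟩

theorem toReal_orbifoldEDist_mem_decreasingPseudoDists :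
    (fun x y => (orbifoldEDist n hn x y).toReal) ∈ (orbifoldDisk n hn).decreasingPseudoDists := by
  refine ⟨isPseudoDist_toReal_orbifoldEDist, fun g hg z w hz hw => ?_⟩
  rw [ENNReal.ofReal_toReal (orbifoldEDist_ne_top _ _)]
  exact orbifoldEDist_map_le hg hz hw

theorem isGreatest_classicalDecreasingPseudoDists :
    IsGreatest (orbifoldDisk n hn).classicalDecreasingPseudoDists
      fun x y => (orbifoldEDist n hn x y).toReal :=
  ⟨PlaneOrbifold.decreasingPseudoDists_subset_classicalDecreasingPseudoDists _
    toReal_orbifoldEDist_mem_decreasingPseudoDists, fun _ hd x y =>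
      (ENNReal.ofReal_le_iff_le_toReal (orbifoldEDist_ne_top x y)).1
        (ofReal_le_orbifoldEDist hd x y)⟩

theorem isGreatest_decreasingPseudoDists :
    IsGreatest (orbifoldDisk n hn).decreasingPseudoDists
      fun x y => (orbifoldEDist n hn x y).toReal :=
  ⟨toReal_orbifoldEDist_mem_decreasingPseudoDists, fun _ hd =>
    isGreatest_classicalDecreasingPseudoDists.2
      (PlaneOrbifold.decreasingPseudoDists_subset_classicalDecreasingPseudoDists _ hd)⟩

theorem sSup_apply_eq_of_isGreatest {α : Type} {S : Set (α → α → ℝ)} {D : α → α → ℝ}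
    (h : IsGreatest S D) (x y : α) : sSup {r | ∃ d ∈ S, d x y = r} = D x y :=
  IsGreatest.csSup_eq ⟨⟨D, h.1, rfl⟩, by rintro _ ⟨d, hd, rfl⟩; exact h.2 hd x y⟩

theorem kobayashiDist_orbifoldDisk :
    (orbifoldDisk n hn).kobayashiDist = fun x y => (orbifoldEDist n hn x y).toReal :=
  funext₂ (sSup_apply_eq_of_isGreatest isGreatest_decreasingPseudoDists)

theorem classicalKobayashiDist_orbifoldDisk :
    (orbifoldDisk n hn).classicalKobayashiDist = fun x y => (orbifoldEDist n hn x y).toReal :=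
  funext₂ (sSup_apply_eq_of_isGreatest isGreatest_classicalDecreasingPseudoDists)

end Kobayashi

end OrbifoldKobayashi

end

theorem mainTheorem5 (n : ℕ∞) (hn : 0 < n) :
    IsGreatest (OrbifoldKobayashi.orbifoldDisk n hn).decreasingPseudoDists
      (OrbifoldKobayashi.orbifoldDisk n hn).kobayashiDist ∧
    IsGreatest (OrbifoldKobayashi.orbifoldDisk n hn).classicalDecreasingPseudoDists
      (OrbifoldKobayashi.orbifoldDisk n hn).classicalKobayashiDist ∧
    (OrbifoldKobayashi.orbifoldDisk n hn).kobayashiDist =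
      (OrbifoldKobayashi.orbifoldDisk n hn).classicalKobayashiDist ∧
    ∀ x y : (OrbifoldKobayashi.orbifoldDisk n hn).Points,
      ENNReal.ofReal ((OrbifoldKobayashi.orbifoldDisk n hn).kobayashiDist x y) =
        OrbifoldKobayashi.inducedEDist
          ((OrbifoldKobayashi.orbifoldDisk n hn).carrier \
            (OrbifoldKobayashi.orbifoldDisk n hn).deltaOne)
          (OrbifoldKobayashi.orbifoldCoeff n) x y := by
  rw [OrbifoldKobayashi.kobayashiDist_orbifoldDisk,
    OrbifoldKobayashi.classicalKobayashiDist_orbifoldDisk]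
  exact ⟨OrbifoldKobayashi.isGreatest_decreasingPseudoDists,
    OrbifoldKobayashi.isGreatest_classicalDecreasingPseudoDists, rfl,
    fun x y => ENNReal.ofReal_toReal (OrbifoldKobayashi.orbifoldEDist_ne_top x y)⟩
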